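/- Let $D\ge 1$ and $M_1,\dots,M_D\ge 1$ be integers, $N=M_1+\dots+M_D$, $\mathbb T=\mathbb R/\mathbb Z$ with Lebesgue measure, and write $\mathbb T^N=\prod_{i=1}^D\mathbb T^{M_i}$, $x=(x^1,\dots,x^D)$ with $x^i=(x^i_1,\dots,x^i_{M_i})\in\mathbb T^{M_i}$. Let $f\in L(\ln^+L)^{D-1}(\mathbb T^N)$, i.e. $f:\mathbb T^N\to\mathbb C$ is measurable and $$\int_{\mathbb T^N}|f(x)|\,\ln^{D-1}(|f(x)|+1)\,dx<\infty .$$ Put $D_l(t)=\sum_{|k|\le l}e^{2\pi i kt}$, $F_n(t)=\frac1{n+1}\sum_{l=0}^nD_l(t)$ and $P_r(t)=\sum_{k\in\mathbb Z}r^{|k|}e^{2\pi i kt}$ for $n\in\mathbb N$ and $0\le r<1$. Define * the Fejér means $\displaystyle \sigma_{\mathbf n}(f,x)=\int_{\mathbb T^N}\prod_{i=1}^D\prod_{j=1}^{M_i}F_{n^i_j}(x^i_j-t^i_j)\,f(t)\,dt$, where $\mathbf n=(n^i_j)$, $n^i_j\in\mathbb N$; * the Abel–Poisson means $\displaystyle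 P_{\mathbf r}(f,x)=\int_{\mathbb T^N}\prod_{i=1}^D\prod_{j=1}^{M_i}P_{r^i_j}(x^i_j-t^i_j)\,f(t)\,dt$, where $\mathbf r=(r^i_j)$, $r^i_j\in[0,1)$; * the $D$-fold Marcinkiewicz means $\displaystyle \sigma^{\Phi}_{\mathbf n}(f,x)=\int_{\mathbb T^N}\prod_{i=1}^D\Big(\frac1{n^i+1}\sum_{l=0}^{n^i}\prod_{j=1}^{M_i}D_l(x^i_j-t^i_j)\Big)f(t)\,dt$, where $\mathbf n=(n^1,\dots,n^D)\in\mathbb N^D$. Then all three converge $D$-boundedly to $f$ almost everywhere on $\mathbb T^N$. That is, for almost every $x\in\mathbb T^N$: 1. for every constant $C$, $\sigma_{\mathbf n}(f,x)\to f(x)$ as all $n^i_j\to\infty$ subject to $n^i_j\le C\,n^i_k$ for all $i$ and all $1\le j,k\le M_i$; 2. for every constant $C$, $P_{\mathbf r}(f,x)\to f(x)$ as all $r^i_j\to1^-$ subject to $1-r^i_j\le C\,(1-r^i_k)$ for all $i$ and all $1\le j,k\le M_i$; 3. $\sigma^{\Phi}_{\mathbf n}(f,x)\to f(x)$ as $n^1,\dots,n^D\to\infty$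 independently. No relation between indices belonging to different blocks is imposed. -/

import Mathlib

open MeasureTheory Filter Topology

noncomputable section

namespace FourierMeans

/-- `f ∈ L (ln⁺ L)^k (X, μ)`: `f` is measurable and `∫ |f| ln^k (|f| + 1) dμ < ∞`.
For `k = 0` this is `L¹`. -/
def MemLLogL {X : Type*} [MeasurableSpace X] (f : X → ℂ) (k : ℕ) (μ : Measure X) : Prop :=
  AEStronglyMeasurable f μ ∧ Integrable (fun x => ‖f x‖ * Real.log (‖f x‖ + 1) ^ k) μ

/-- The product `𝕋^{M_1} × ⋯ × 𝕋^{M_D} = 𝕋^N`, `N = M_1 + ⋯ + M_D`, where `𝕋 = ℝ / ℤ`.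
A point `x` has blocks `x i ∈ 𝕋^{M_i}`; `volume` is Lebesgue measure (of total mass one). -/
abbrev BlockTorus {D : ℕ} (M : Fin D → ℕ) : Type :=
  (i : Fin D) → Fin (M i) → UnitAddCircle

/-- The Dirichlet kernel `D_n(t) = ∑_{|k| ≤ n} e^{2πikt}`. -/
def dirichletKernel (n : ℕ) (t : UnitAddCircle) : ℂ :=
  ∑ k ∈ Finset.Icc (-(n : ℤ)) (n : ℤ), fourier k t

/-- The one-dimensional Fejér kernel `(D_0 + ⋯ + D_n) / (n + 1)`. -/
def fejerKernel (n : ℕ) (t : UnitAddCircle) : ℂ :=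
  ((n : ℂ) + 1)⁻¹ * ∑ l ∈ Finset.range (n + 1), dirichletKernel l t

/-- The one-dimensional Poisson kernel `∑_{k ∈ ℤ} r^{|k|} e^{2πikt}`, for `0 ≤ r < 1`
(an absolutely convergent series). -/
def poissonKernel (r : ℝ) (t : UnitAddCircle) : ℂ :=
  ∑' k : ℤ, (r : ℂ) ^ k.natAbs * fourier k t

/-- The Fejér kernel on `𝕋^m` with multi-index `n = (n_1, …, n_m)`. -/
def fejerKernelMulti {m : ℕ} (n : Fin m → ℕ) (t : Fin m → UnitAddCircle) : ℂ :=
  ∏ j, fejerKernel (n j) (t j)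

/-- The Poisson kernel on `𝕋^m` with parameters `r = (r_1, …, r_m)`. -/
def poissonKernelMulti {m : ℕ} (r : Fin m → ℝ) (t : Fin m → UnitAddCircle) : ℂ :=
  ∏ j, poissonKernel (r j) (t j)

/-- The Marcinkiewicz kernel on `𝕋^m`: the arithmetic mean of the cubic Dirichlet kernels
`D_l(t_1) ⋯ D_l(t_m)`, `l = 0, …, n`. -/
def marcinkiewiczKernel {m : ℕ} (n : ℕ) (t : Fin m → UnitAddCircle) : ℂ :=
  ((n : ℂ) + 1)⁻¹ * ∑ l ∈ Finset.range (n + 1), ∏ j, dirichletKernel l (t j)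

/-- The operator `f ↦ ∫ ∏_i K_i(x^i - t^i) f(t) dt`, with one kernel `K_i` on each `𝕋^{M_i}`. -/
def blockMean {D : ℕ} {M : Fin D → ℕ} (K : (i : Fin D) → (Fin (M i) → UnitAddCircle) → ℂ)
    (f : BlockTorus M → ℂ) (x : BlockTorus M) : ℂ :=
  ∫ t : BlockTorus M, (∏ i, K i (x i - t i)) * f t

/-- The Fejér means of `f`, with multi-index `n^i = (n^i_1, …, n^i_{M_i})` in the `i`-th block. -/
def fejerMean {D : ℕ} {M : Fin D → ℕ} (n : (i : Fin D) → Fin (M i) → ℕ)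
    (f : BlockTorus M → ℂ) (x : BlockTorus M) : ℂ :=
  blockMean (fun i => fejerKernelMulti (n i)) f x

/-- The Abel–Poisson means of `f`, with parameters `r^i = (r^i_1, …, r^i_{M_i})`. -/
def abelPoissonMean {D : ℕ} {M : Fin D → ℕ} (r : (i : Fin D) → Fin (M i) → ℝ)
    (f : BlockTorus M → ℂ) (x : BlockTorus M) : ℂ :=
  blockMean (fun i => poissonKernelMulti (r i)) f x

/-- The `D`-fold Marcinkiewicz means of `f`, with one natural index `n i` for each block. -/
def marcinkiewiczMean {D : ℕ} {M : Fin D → ℕ} (n : Fin D → ℕ)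
    (f : BlockTorus M → ℂ) (x : BlockTorus M) : ℂ :=
  blockMean (fun i => marcinkiewiczKernel (n i)) f x

/-- `D`-bounded growth with constant `C`: all indices tend to infinity, independently of each
other, except that inside each block the ratios of the indices are at most `C`. -/
def boundedGrowth {D : ℕ} (M : Fin D → ℕ) (C : ℝ) : Filter ((i : Fin D) → Fin (M i) → ℕ) :=
  atTop ⊓ 𝓟 {n | ∀ i, ∀ j k : Fin (M i), (n i j : ℝ) ≤ C * (n i k : ℝ)}

/-- `D`-bounded growth of Abel–Poisson parameters with constant `C`: all `r^i_j ∈ [0, 1)` tend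
to `1`, and inside each block the ratios of the numbers `1 - r^i_j` are at most `C`. -/
def boundedGrowthAbel {D : ℕ} (M : Fin D → ℕ) (C : ℝ) :
    Filter ((i : Fin D) → Fin (M i) → ℝ) :=
  𝓝 (fun _ _ => 1) ⊓ 𝓟 {r | (∀ i, ∀ j : Fin (M i), 0 ≤ r i j ∧ r i j < 1) ∧
    ∀ i, ∀ j k : Fin (M i), 1 - r i j ≤ C * (1 - r i k)}

end FourierMeans

end

/-! All three means converge everywhere for trigonometric polynomials, so the theorem rests on a
maximal inequality. On one block 𝕋^m a single operator, `torusMaximal`, dominates all the kernels.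
It is a weighted sum, over shears and eccentricities `a`, of maximal averages over the dilates by `2
^ (-k)` of one sheared box. For a fixed shape these dilates form a one-parameter nested family, so a
Vitali covering gives weak type (1,1) with a constant `4 ^ m` independent of the shape. The weights
decay geometrically in `a`, so the weak type bounds can be added.

Fejér and Poisson kernels with comparable parameters need only unsheared boxes, because of their
size and quadratic decay (`isBoxDominated_prod`). The Marcinkiewicz kernel is not a product. Let `S`
be the set of coordinates with `‖x_j‖ ≥ 1/(n+1)`. Multiplying the kernel by `∏ (e^{2πi x_j} - 1)`
over `S` yields exponential sums in `l` whose frequencies are signed sums of these coordinates.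
Summation by parts shows that they are large only where a signed sum is small, and the shears turn
that region into a box (`marcinkiewiczKernel_bound_of_large`).

The `D` blocks are handled by composing the blockwise operators. Each maps L(ln⁺L)^(k+1) into
L(ln⁺L)^k, so `D - 1` of them lead to L¹, where the last is applied through its weak type bound
(`ae_iInf_iterOp_eq_zero`). Approximation is done through monotone majorants: choose trigonometric
polynomials `g_n → f` a.e. with `sup_n |f - g_n|` in the given class. The tails `G_N = sup_{n ≥ N}
|f - g_n|` decrease to zero a.e., and so do their composed maximal functions. A three-epsilon
argument concludes. The maximal operator depends neither on the kernels nor on `C`, so one null set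
serves every case. -/

noncomputable section
namespace FourierMeans
open scoped ENNReal

/-! ### Dyadic L(ln⁺L)^k classes -/

/-- A maximal operator on nonnegative functions: monotone, of weak type `(1, 1)`, and compatible
with adding constants. -/
structure IsMaximalOperator {X : Type*} [MeasurableSpace X] (μ : Measure X)
    (T : (X → ℝ≥0∞) → X → ℝ≥0∞) (b : ℕ) (C : ℝ≥0∞) : Prop where
  mono : ∀ ⦃g h : X → ℝ≥0∞⦄, g ≤ h → T g ≤ T h
  measurable : ∀ ⦃g : X → ℝ≥0∞⦄, Measurable g → Measurable (T g)
  add_const : ∀ ⦃g : X → ℝ≥0∞⦄, Measurable g → ∀ (c : ℝ≥0∞) (x : X),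
    T (fun y => g y + c) x ≤ T g x + 2 ^ b * c
  weak_type : ∀ ⦃g : X → ℝ≥0∞⦄, Measurable g → ∀ l : ℝ≥0∞,
    l * μ {x | l < T g x} ≤ C * ∫⁻ x, g x ∂μ

/-- A dyadic form of the integral `∫ h ln^k (h + 1) dμ`. -/
def dyadicLLog {X : Type*} [MeasurableSpace X] (μ : Measure X) (k : ℕ) (h : X → ℝ≥0∞) : ℝ≥0∞ :=
  ∑' n : ℕ, ((n : ℝ≥0∞) + 1) ^ k * (2 ^ n * μ {x | 2 ^ n < h x})

/-- The composition `T_{i₁} ∘ T_{i₂} ∘ ⋯` along a list of indices. -/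
def iterOp {X ι : Type*} (T : ι → (X → ℝ≥0∞) → X → ℝ≥0∞) (l : List ι) (h : X → ℝ≥0∞) : X → ℝ≥0∞ :=
  l.foldr (fun i g => T i g) h

@[simp] lemma iterOp_nil {X ι : Type*} (T : ι → (X → ℝ≥0∞) → X → ℝ≥0∞) (h : X → ℝ≥0∞) : iterOp T [] h = h := rfl
@[simp] lemma iterOp_cons {X ι : Type*} (T : ι → (X → ℝ≥0∞) → X → ℝ≥0∞) (i : ι) (l : List ι) (h : X → ℝ≥0∞) :
    iterOp T (i :: l) h = T i (iterOp T l h) := rfl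

section
variable {X : Type*} [MeasurableSpace X] {μ : Measure X}

lemma dyadicLLog_mono (k : ℕ) {g h : X → ℝ≥0∞} (hgh : g ≤ h) :
    dyadicLLog μ k g ≤ dyadicLLog μ k h := by
  unfold dyadicLLog
  gcongr with n x
  exact hgh x

lemma dyadicLLog_mono_exponent {k l : ℕ} (hkl : k ≤ l) (h : X → ℝ≥0∞) :
    dyadicLLog μ k h ≤ dyadicLLog μ l h := by
  unfold dyadicLLog
  refine ENNReal.tsum_le_tsum fun n => mul_le_mul_left (pow_le_pow_right₀ ?_ hkl) _
  exact le_add_self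

/-- Finiteness of the dyadic sum may be checked after dilating the levels. -/
lemma dyadicLLog_lt_top_of_shift [IsFiniteMeasure μ] (k q : ℕ) {h : X → ℝ≥0∞}
    (hh : ∑' n : ℕ, ((n : ℝ≥0∞) + 1) ^ k * (2 ^ n * μ {x | 2 ^ (n + q) < h x}) < ∞) :
    dyadicLLog μ k h < ∞ := by
  have hsplit : dyadicLLog μ k h =
      (∑ n ∈ Finset.range q, ((n : ℝ≥0∞) + 1) ^ k * (2 ^ n * μ {x | 2 ^ n < h x})) +
      ∑' n : ℕ, (((n + q : ℕ) : ℝ≥0∞) + 1) ^ k * (2 ^ (n + q) * μ {x | 2 ^ (n + q) < h x}) :=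
    (Summable.sum_add_tsum_nat_add' (f := fun n : ℕ =>
      ((n : ℝ≥0∞) + 1) ^ k * (2 ^ n * μ {x | 2 ^ n < h x})) ENNReal.summable).symm
  rw [hsplit]
  refine ENNReal.add_lt_top.2 ⟨?_, ?_⟩
  · refine ENNReal.sum_lt_top.2 fun n _ => ?_
    refine ENNReal.mul_lt_top (ENNReal.pow_lt_top (by simp)) (ENNReal.mul_lt_top ?_ ?_)
    · exact ENNReal.pow_lt_top (by simp)
    · exact measure_lt_top _ _
  · refine lt_of_le_of_lt (b := ((q : ℝ≥0∞) + 1) ^ k * 2 ^ q *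
      ∑' n : ℕ, ((n : ℝ≥0∞) + 1) ^ k * (2 ^ n * μ {x | 2 ^ (n + q) < h x})) ?_ ?_
    · rw [← ENNReal.tsum_mul_left]
      refine ENNReal.tsum_le_tsum fun n => ?_
      have h1 : (((n + q : ℕ) : ℝ≥0∞) + 1) ≤ ((q : ℝ≥0∞) + 1) * ((n : ℝ≥0∞) + 1) := by
        have : n + q + 1 ≤ (q + 1) * (n + 1) := by nlinarith
        exact_mod_cast this
      calc _ ≤ (((q : ℝ≥0∞) + 1) * ((n : ℝ≥0∞) + 1)) ^ k *
            (2 ^ (n + q) * μ {x | 2 ^ (n + q) < h x}) := by gcongr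
        _ = _ := by rw [mul_pow, pow_add]; ring
    · refine ENNReal.mul_lt_top (ENNReal.mul_lt_top (ENNReal.pow_lt_top (by simp)) ?_) hh
      exact ENNReal.pow_lt_top (by simp)

lemma dyadicLLog_shift_lt_top [IsFiniteMeasure μ] {k : ℕ} {h : X → ℝ≥0∞}
    (hh : dyadicLLog μ k h < ∞) :
    ∑' n : ℕ, ((n : ℝ≥0∞) + 1) ^ k * (2 ^ (n + 1) * μ {x | 2 ^ n < h x}) < ∞ := by
  have : ∑' n : ℕ, ((n : ℝ≥0∞) + 1) ^ k * (2 ^ (n + 1) * μ {x | 2 ^ n < h x}) =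
      2 * dyadicLLog μ k h := by
    rw [dyadicLLog, ← ENNReal.tsum_mul_left]
    congr 1; ext n; rw [pow_succ]; ring
  rw [this]
  exact ENNReal.mul_lt_top (by simp) hh

/-- If a sum exceeds `2 ^ (n + 1)`, one of the summands exceeds `2 ^ n`; the shift by one level is
harmless. -/
lemma dyadicLLog_add_lt_top [IsFiniteMeasure μ] {k : ℕ} {g h : X → ℝ≥0∞}
    (hg : dyadicLLog μ k g < ∞) (hh : dyadicLLog μ k h < ∞) :
    dyadicLLog μ k (fun x => g x + h x) < ∞ := by
  refine dyadicLLog_lt_top_of_shift k 1 (lt_of_le_of_lt ?_ (ENNReal.add_lt_top.2 ⟨hg, hh⟩))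
  unfold dyadicLLog
  rw [← ENNReal.tsum_add]
  refine ENNReal.tsum_le_tsum fun n => ?_
  rw [← mul_add, ← mul_add]
  gcongr
  refine (measure_mono ?_).trans (measure_union_le _ _)
  intro x hx
  simp only [Set.mem_ofPred_eq, Set.mem_union, pow_succ] at hx ⊢
  by_contra! hcon
  refine absurd hx (not_lt.2 ?_)
  rw [mul_two]
  exact add_le_add hcon.1 hcon.2

/-- A nonnegative number above `2 ^ n` is controlled by the dyadic levels it exceeds. -/
lemma le_tsum_dyadic_levels {n : ℕ} {u : ℝ≥0∞} (hu : 2 ^ n < u) :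
    u ≤ ∑' m : ℕ, if n ≤ m ∧ 2 ^ m < u then (2 : ℝ≥0∞) ^ (m + 1) else 0 := by
  rcases eq_or_ne u ∞ with rfl | hfin
  · refine le_of_forall_lt fun c hc => ?_
    obtain ⟨m, hm⟩ : ∃ m : ℕ, c < (m : ℝ≥0∞) := ENNReal.exists_nat_gt hc.ne
    refine lt_of_lt_of_le hm (le_trans ?_ (ENNReal.le_tsum (max n m)))
    rw [if_pos ⟨le_max_left _ _, ENNReal.pow_lt_top (by simp)⟩]
    have : m ≤ 2 ^ (max n m + 1) :=
      (Nat.lt_two_pow_self (n := m)).le.trans (Nat.pow_le_pow_right (by norm_num) (by omega))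
    exact_mod_cast this
  · obtain ⟨N, hN⟩ : ∃ N : ℕ, u ≤ 2 ^ N := by
      obtain ⟨m, hm⟩ := ENNReal.exists_nat_gt hfin
      refine ⟨m, hm.le.trans ?_⟩
      exact_mod_cast (Nat.lt_two_pow_self (n := m)).le
    classical
    have hex : ∃ N : ℕ, u ≤ 2 ^ N := ⟨N, hN⟩
    -- With `m + 1` the least exponent such that `u ≤ 2 ^ (m + 1)`, the single term of index `m`
    -- already bounds `u`.
    have hspec := Nat.find_spec hex
    have hlt : n < Nat.find hex := by
      by_contra! hle
      refine absurd hu (not_lt.2 (hspec.trans ?_))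
      exact pow_le_pow_right₀ (by norm_num) hle
    obtain ⟨m, hm⟩ : ∃ m, Nat.find hex = m + 1 := ⟨Nat.find hex - 1, by omega⟩
    have hcond : n ≤ m ∧ 2 ^ m < u := ⟨by omega, not_le.1 (Nat.find_min hex (by omega))⟩
    refine le_trans ?_ (ENNReal.le_tsum m)
    rw [if_pos hcond]
    rwa [hm] at hspec

lemma setLIntegral_le_tsum_dyadic {h : X → ℝ≥0∞} (hh : Measurable h) (n : ℕ) :
    ∫⁻ x in {x | 2 ^ n < h x}, h x ∂μ ≤
      ∑' m : ℕ, if n ≤ m then 2 ^ (m + 1) * μ {x | 2 ^ m < h x} else 0 := by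
  have hlev : ∀ m : ℕ, MeasurableSet {x | 2 ^ m < h x} := fun m =>
    measurableSet_lt measurable_const hh
  rw [← lintegral_indicator (hlev n)]
  calc ∫⁻ x, {x | 2 ^ n < h x}.indicator h x ∂μ
      ≤ ∫⁻ x, ∑' m : ℕ, (if n ≤ m then
          {x | 2 ^ m < h x}.indicator (fun _ => (2 : ℝ≥0∞) ^ (m + 1)) x else 0) ∂μ := by
        refine lintegral_mono fun x => ?_
        by_cases hx : 2 ^ n < h x
        · rw [Set.indicator_of_mem (by exact hx)]
          refine (le_tsum_dyadic_levels hx).trans (ENNReal.tsum_le_tsum fun m => ?_)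
          by_cases h1 : n ≤ m <;> by_cases h2 : 2 ^ m < h x <;> simp [h1, h2]
        · rw [Set.indicator_of_notMem (by exact hx)]; exact zero_le
    _ = _ := by
        rw [lintegral_tsum]
        · congr 1; ext m
          split_ifs
          · rw [lintegral_indicator (hlev m), lintegral_const, Measure.restrict_apply_univ]
          · simp
        · intro m
          split_ifs
          · exact (measurable_const.indicator (hlev m)).aemeasurable
          · exact aemeasurable_const

/-- Exchanging the sums over `n ≤ m` leaves `∑_{n ≤ m} (n + 1) ^ k ≤ (m + 1) ^ (k + 1)`. This is
where a logarithm is lost. -/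
lemma sum_setLIntegral_le (k : ℕ) {h : X → ℝ≥0∞} (hh : Measurable h) :
    ∑' n : ℕ, ((n : ℝ≥0∞) + 1) ^ k * ∫⁻ x in {x | 2 ^ n < h x}, h x ∂μ ≤
      2 * dyadicLLog μ (k + 1) h := by
  calc _ ≤ ∑' n : ℕ, ∑' m : ℕ, ((n : ℝ≥0∞) + 1) ^ k *
        (if n ≤ m then 2 ^ (m + 1) * μ {x | 2 ^ m < h x} else 0) := by
        refine ENNReal.tsum_le_tsum fun n => ?_
        rw [ENNReal.tsum_mul_left]
        gcongr
        exact setLIntegral_le_tsum_dyadic hh n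
    _ = ∑' m : ℕ, ∑' n : ℕ, ((n : ℝ≥0∞) + 1) ^ k *
        (if n ≤ m then 2 ^ (m + 1) * μ {x | 2 ^ m < h x} else 0) := ENNReal.tsum_comm
    _ ≤ ∑' m : ℕ, 2 * (((m : ℝ≥0∞) + 1) ^ (k + 1) * (2 ^ m * μ {x | 2 ^ m < h x})) := by
        refine ENNReal.tsum_le_tsum fun m => ?_
        rw [tsum_eq_sum (s := Finset.range (m + 1))]
        · calc _ ≤ ∑ n ∈ Finset.range (m + 1), ((m : ℝ≥0∞) + 1) ^ k *
                (2 ^ (m + 1) * μ {x | 2 ^ m < h x}) := by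
                refine Finset.sum_le_sum fun n hn => ?_
                have hnm : n ≤ m := by simpa [Nat.lt_succ_iff] using hn
                rw [if_pos hnm]
                gcongr
            _ = _ := by
                rw [Finset.sum_const, Finset.card_range, nsmul_eq_mul]
                push_cast
                rw [pow_succ, pow_succ]; ring
        · intro n hn
          rw [if_neg (by simpa [Nat.lt_succ_iff] using hn), mul_zero]
    _ = _ := by rw [ENNReal.tsum_mul_left, dyadicLLog]

/-- Above height 1 the dyadic levels control `h`; below it the finiteness of the measure does. -/
lemma lintegral_lt_top_of_dyadicLLog [IsFiniteMeasure μ] {k : ℕ} {h : X → ℝ≥0∞}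
    (hh : Measurable h) (hfin : dyadicLLog μ k h < ∞) : ∫⁻ x, h x ∂μ < ∞ := by
  have h0 : dyadicLLog μ 0 h < ∞ := (dyadicLLog_mono_exponent (Nat.zero_le k) h).trans_lt hfin
  have h1 : ∫⁻ x in {x | 2 ^ 0 < h x}, h x ∂μ < ∞ := by
    refine (setLIntegral_le_tsum_dyadic hh 0).trans_lt ?_
    simpa using dyadicLLog_shift_lt_top h0
  have hm : MeasurableSet {x | 2 ^ 0 < h x} := measurableSet_lt measurable_const hh
  rw [← lintegral_add_compl h hm]
  refine ENNReal.add_lt_top.2 ⟨h1, ?_⟩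
  calc ∫⁻ x in {x | 2 ^ 0 < h x}ᶜ, h x ∂μ ≤ ∫⁻ x in {x | 2 ^ 0 < h x}ᶜ, 1 ∂μ :=
        setLIntegral_mono measurable_const fun x hx => by simpa using hx
    _ < ∞ := by
        rw [setLIntegral_const]; exact ENNReal.mul_lt_top (by simp) (measure_lt_top _ _)

/-! ### Maximal operators and their compositions on these classes -/

namespace IsMaximalOperator
variable {T : (X → ℝ≥0∞) → X → ℝ≥0∞} {b : ℕ} {C : ℝ≥0∞}

/-- Truncation at height `2 ^ n`: the bounded part of `h` contributes at most `2 ^ (n + b)` to `T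
h`, so above `2 ^ (n + b + 1)` the part where `h > 2 ^ n` must account for the rest, and the weak
type bound applies to it alone. -/
lemma measure_le (hT : IsMaximalOperator μ T b C) {h : X → ℝ≥0∞} (hh : Measurable h) (n : ℕ) :
    2 ^ n * μ {x | 2 ^ (n + (b + 1)) < T h x} ≤ C * ∫⁻ x in {x | 2 ^ n < h x}, h x ∂μ := by
  have hm : MeasurableSet {x | 2 ^ n < h x} := measurableSet_lt measurable_const hh
  rw [← lintegral_indicator hm]
  set g := {x | 2 ^ n < h x}.indicator h with hg
  have hgm : Measurable g := hh.indicator hm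
  have hle : h ≤ fun y => g y + 2 ^ n := by
    intro y
    by_cases hy : 2 ^ n < h y
    · simp [hg, hy]
    · simp only [hg, Set.indicator, Set.mem_ofPred_eq, hy, if_false, zero_add]
      exact not_lt.1 hy
  have hsub : {x | (2 : ℝ≥0∞) ^ (n + (b + 1)) < T h x} ⊆ {x | 2 ^ (n + b) < T g x} := by
    intro x hx
    simp only [Set.mem_ofPred_eq] at hx ⊢
    by_contra! hcon
    refine absurd hx (not_lt.2 ?_)
    calc T h x ≤ T g x + 2 ^ b * 2 ^ n := (hT.mono hle x).trans (hT.add_const hgm _ x)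
      _ ≤ 2 ^ (n + b) + 2 ^ b * 2 ^ n := by gcongr
      _ = 2 ^ (n + (b + 1)) := by ring
  calc 2 ^ n * μ {x | 2 ^ (n + (b + 1)) < T h x} ≤ 2 ^ (n + b) * μ {x | 2 ^ (n + b) < T g x} := by
        gcongr
        · norm_num
        · omega
    _ ≤ C * ∫⁻ x, g x ∂μ := hT.weak_type hgm _

/-- Summing the truncated weak type bounds over all levels costs exactly one logarithm. -/
lemma dyadicLLog_lt_top [IsFiniteMeasure μ] (hT : IsMaximalOperator μ T b C) (hC : C ≠ ∞)
    {k : ℕ} {h : X → ℝ≥0∞} (hh : Measurable h) (hfin : dyadicLLog μ (k + 1) h < ∞) :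
    dyadicLLog μ k (T h) < ∞ := by
  refine dyadicLLog_lt_top_of_shift k (b + 1) (lt_of_le_of_lt (b := C * (2 *
    dyadicLLog μ (k + 1) h)) ?_ (ENNReal.mul_lt_top hC.lt_top (ENNReal.mul_lt_top (by simp) hfin)))
  refine le_trans ?_ (mul_le_mul_right (sum_setLIntegral_le k hh) C)
  rw [← ENNReal.tsum_mul_left]
  refine ENNReal.tsum_le_tsum fun n => ?_
  rw [mul_left_comm C]
  exact mul_le_mul_right (hT.measure_le hh n) _

/-- A maximal operator preserves almost everywhere decrease to zero of integrable functions. -/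
lemma ae_iInf_eq_zero (hT : IsMaximalOperator μ T b C) (hC : C ≠ ∞)
    {G : ℕ → X → ℝ≥0∞} (hm : ∀ n, Measurable (G n)) (hanti : Antitone G)
    (hint : ∫⁻ x, G 0 x ∂μ < ∞) (h0 : ∀ᵐ x ∂μ, ⨅ n, G n x = 0) :
    ∀ᵐ x ∂μ, ⨅ n, T (G n) x = 0 := by
  have hlim : ⨅ n, ∫⁻ x, G n x ∂μ = 0 := by
    rw [← lintegral_iInf hm hanti hint.ne]
    rw [lintegral_congr_ae h0, lintegral_zero]
  have hlev : ∀ q : ℕ, μ {x | 2⁻¹ ^ q < ⨅ n, T (G n) x} = 0 := by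
    intro q
    have hq0 : (2⁻¹ : ℝ≥0∞) ^ q ≠ 0 := by simp
    -- The level set of the infimum lies in that of every `T (G n)`, so the weak type bound holds
    -- for each `n` and its right side tends to zero.
    have hle : ∀ n, 2⁻¹ ^ q * μ {x | 2⁻¹ ^ q < ⨅ n, T (G n) x} ≤ C * ∫⁻ x, G n x ∂μ := by
      intro n
      refine le_trans ?_ (hT.weak_type (hm n) (2⁻¹ ^ q))
      gcongr with x
      exact iInf_le _ n
    have : 2⁻¹ ^ q * μ {x | 2⁻¹ ^ q < ⨅ n, T (G n) x} ≤ C * ⨅ n, ∫⁻ x, G n x ∂μ := by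
      rw [ENNReal.mul_iInf fun h => absurd h hC]
      exact le_iInf hle
    rw [hlim, mul_zero, nonpos_iff_eq_zero, mul_eq_zero] at this
    exact this.resolve_left hq0
  have : ∀ᵐ x ∂μ, ∀ q : ℕ, ⨅ n, T (G n) x ≤ 2⁻¹ ^ q := by
    rw [ae_all_iff]
    intro q
    rw [ae_iff]
    simpa only [not_le] using hlev q
  filter_upwards [this] with x hx
  refine le_antisymm (ge_of_tendsto' (ENNReal.tendsto_pow_atTop_nhds_zero_of_lt_one ?_) hx) zero_le
  exact ENNReal.inv_lt_one.2 (by norm_num)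

end IsMaximalOperator

section iterOp
variable {ι : Type*} {T : ι → (X → ℝ≥0∞) → X → ℝ≥0∞} {b : ι → ℕ} {C : ι → ℝ≥0∞}

lemma iterOp_mono (hT : ∀ i, IsMaximalOperator μ (T i) (b i) (C i)) (l : List ι) :
    Monotone (iterOp T l) := by
  induction l with
  | nil => exact fun _ _ h => h
  | cons i l ih => exact fun _ _ h => (hT i).mono (ih h)

lemma measurable_iterOp (hT : ∀ i, IsMaximalOperator μ (T i) (b i) (C i)) (l : List ι)
    {h : X → ℝ≥0∞} (hh : Measurable h) : Measurable (iterOp T l h) := by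
  induction l with
  | nil => exact hh
  | cons i l ih => exact (hT i).measurable ih

lemma dyadicLLog_iterOp_lt_top [IsFiniteMeasure μ]
    (hT : ∀ i, IsMaximalOperator μ (T i) (b i) (C i)) (hC : ∀ i, C i ≠ ∞) (l : List ι)
    (k : ℕ) {h : X → ℝ≥0∞} (hh : Measurable h) (hfin : dyadicLLog μ (k + l.length) h < ∞) :
    dyadicLLog μ k (iterOp T l h) < ∞ := by
  induction l generalizing k with
  | nil => exact hfin
  | cons i l ih =>
    refine (hT i).dyadicLLog_lt_top (hC i) (measurable_iterOp hT l hh) (ih (k + 1) ?_)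
    rwa [List.length_cons, ← add_assoc, add_right_comm] at hfin

/-- Composing `d` maximal operators preserves almost everywhere decrease to zero on
`L (ln⁺ L)^{d - 1}`. -/
lemma ae_iInf_iterOp_eq_zero [IsFiniteMeasure μ]
    (hT : ∀ i, IsMaximalOperator μ (T i) (b i) (C i)) (hC : ∀ i, C i ≠ ∞) (l : List ι)
    {G : ℕ → X → ℝ≥0∞} (hm : ∀ n, Measurable (G n)) (hanti : Antitone G)
    (hfin : dyadicLLog μ (l.length - 1) (G 0) < ∞) (h0 : ∀ᵐ x ∂μ, ⨅ n, G n x = 0) :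
    ∀ᵐ x ∂μ, ⨅ n, iterOp T l (G n) x = 0 := by
  induction l with
  | nil => exact h0
  | cons i l ih =>
    -- The outermost operator only needs an integrable argument, so only the inner `l.length`
    -- operators consume logarithms.
    have hfin' : dyadicLLog μ (0 + l.length) (G 0) < ∞ := by simpa using hfin
    refine (hT i).ae_iInf_eq_zero (hC i) (fun n => measurable_iterOp hT l (hm n))
      (fun m n hmn => iterOp_mono hT l (hanti hmn)) ?_ (ih ?_)
    · exact lintegral_lt_top_of_dyadicLLog (measurable_iterOp hT l (hm 0))
        (dyadicLLog_iterOp_lt_top hT hC l 0 (hm 0) hfin')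
    · exact (dyadicLLog_mono_exponent (by omega) _).trans_lt hfin'

end iterOp
end

/-! ### Weak type inequalities: covering and summation -/

/-- Weak type `(1, 1)` inequality for the maximal function of averages over translates of a
decreasing sequence of sets with controlled difference sets. -/
lemma weak_type_nested_averages {G : Type*} [AddCommGroup G] [MeasurableSpace G]
    [MeasurableAdd₂ G] [MeasurableNeg G] (μ : Measure G) [μ.IsAddLeftInvariant] [μ.IsNegInvariant]
    (B B' : ℕ → Set G) (hB : ∀ k, MeasurableSet (B k))
    (hB' : ∀ k, MeasurableSet (B' k)) (hanti : Antitone B)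
    (hzero : ∀ k, (0 : G) ∈ B k) (hdiff : ∀ k, ∀ u ∈ B k, ∀ v ∈ B k, u - v ∈ B' k)
    (V : ℕ → ℝ≥0∞) (C : ℝ≥0∞) (hC : C ≠ 0) (hV : ∀ k, V k * μ (B' k) ≤ C)
    (g : G → ℝ≥0∞) (l : ℝ≥0∞) :
    l * μ {y | l < ⨆ k, V k * ∫⁻ t in {t | y - t ∈ B k}, g t ∂μ} ≤ C * ∫⁻ t, g t ∂μ := by
  rcases eq_or_ne (∫⁻ t, g t ∂μ) ∞ with hint | hint
  · rw [hint, ENNReal.mul_top hC]; exact le_top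
  set ν := μ.withDensity g with hν
  set D : G × ℕ → Set G := fun p => {t | p.1 - t ∈ B p.2} with hD
  have hDm : ∀ p, MeasurableSet (D p) := fun p => (measurable_const_sub p.1) (hB p.2)
  have hνD : ∀ p, ν (D p) = ∫⁻ t in D p, g t ∂μ := fun p => withDensity_apply _ (hDm p)
  set S : Set (G × ℕ) := {p | l < V p.2 * ν (D p)} with hS
  -- The set of index `k` is given size `2 ^ (-k)`. As the enlargement ratio 3/2 is below 2, the
  -- selected set meeting a given one has index at most `k`.
  obtain ⟨u, huS, hdisj, hcov⟩ := Vitali.exists_disjoint_subfamily_covering_enlargement D S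
    (fun p => (1 / 2 : ℝ) ^ p.2) (3 / 2) (by norm_num) (fun p _ => by positivity) 1
    (fun p _ => pow_le_one₀ (by norm_num) (by norm_num))
    (fun p _ => ⟨p.1, by simp [hD, hzero]⟩)
  have hsum : ∑' p : u, ν (D p) ≤ ∫⁻ t, g t ∂μ := by
    calc ∑' p : u, ν (D p) ≤ ν (⋃ p : u, D p) := by
          refine tsum_meas_le_meas_iUnion_of_disjoint ν (fun p => hDm p) ?_
          intro p q hpq
          exact hdisj p.2 q.2 (fun h => hpq (Subtype.ext h))
      _ ≤ ν Set.univ := measure_mono (Set.subset_univ _)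
      _ = _ := by rw [hν, withDensity_apply _ MeasurableSet.univ, Measure.restrict_univ]
  -- The selected sets are disjoint, of positive `ν`-mass, and of finite total mass, hence countable
  -- in number.
  have hcount : u.Countable := by
    have h1 := Summable.countable_support_ennreal (f := fun p : u => ν (D p))
      (ne_top_of_le_ne_top hint hsum)
    have h2 : Function.support (fun p : u => ν (D p)) = Set.univ := by
      ext p
      simp only [Function.mem_support, Set.mem_univ, iff_true]
      intro h0
      have := huS p.2
      simp only [hS, Set.mem_ofPred_eq, h0, mul_zero] at this
      exact not_lt_zero this
    rw [h2, Set.countable_univ_iff] at h1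
    exact h1.to_set
  have hsub : {y | l < ⨆ k, V k * ∫⁻ t in {t | y - t ∈ B k}, g t ∂μ} ⊆
      ⋃ p ∈ u, {y | p.1 - y ∈ B' p.2} := by
    intro y hy
    obtain ⟨k, hk⟩ := lt_iSup_iff.1 (show l < ⨆ k, V k * ∫⁻ t in {t | y - t ∈ B k}, g t ∂μ from hy)
    have hmem : (y, k) ∈ S := by
      simp only [hS, Set.mem_ofPred_eq, hνD]
      exact hk
    obtain ⟨p, hp, ⟨s, hs1, hs2⟩, hle⟩ := hcov _ hmem
    refine Set.mem_biUnion hp ?_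
    have hkp : p.2 ≤ k := by
      by_contra! hlt
      have : (1 / 2 : ℝ) ^ p.2 ≤ (1 / 2) ^ (k + 1) :=
        pow_le_pow_of_le_one (by norm_num) (by norm_num) hlt
      rw [pow_succ] at this
      have hpos : (0 : ℝ) < (1 / 2) ^ k := by positivity
      simp only at hle
      linarith
    -- For a common point `s`, both `p.1 - s` and `y - s` lie in `B p.2`, so their difference `p.1 -
    -- y` lies in `B' p.2`.
    have := hdiff p.2 _ hs2 _ (hanti hkp hs1)
    simpa using this
  calc l * μ {y | l < ⨆ k, V k * ∫⁻ t in {t | y - t ∈ B k}, g t ∂μ}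
      ≤ l * ∑' p : u, μ (B' (p : G × ℕ).2) := by
        gcongr
        refine (measure_mono hsub).trans ((measure_biUnion_le μ hcount _).trans ?_)
        refine ENNReal.tsum_le_tsum fun p => le_of_eq ?_
        exact (Measure.measurePreserving_sub_left μ _).measure_preimage (hB' _).nullMeasurableSet
    _ = ∑' p : u, l * μ (B' (p : G × ℕ).2) := ENNReal.tsum_mul_left.symm
    _ ≤ ∑' p : u, C * ν (D p) := by
        refine ENNReal.tsum_le_tsum fun p => ?_
        calc l * μ (B' (p : G × ℕ).2)
            ≤ V (p : G × ℕ).2 * ν (D p) * μ (B' (p : G × ℕ).2) := by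
              gcongr
              exact (huS p.2).le
          _ = V (p : G × ℕ).2 * μ (B' (p : G × ℕ).2) * ν (D p) := by ring
          _ ≤ C * ν (D p) := by gcongr; exact hV _
    _ = C * ∑' p : u, ν (D p) := ENNReal.tsum_mul_left
    _ ≤ C * ∫⁻ t, g t ∂μ := by gcongr

/-- A weighted sum of weak type `(1, 1)` functions is of weak type `(1, 1)` if the square roots
of the weights are summable. -/
lemma weak_type_tsum {X ι : Type*} [Countable ι] [MeasurableSpace X] {μ : Measure X}
    (s : ι → ℝ≥0∞) (hs0 : ∀ i, s i ≠ 0) (hst : ∑' i, s i ≠ ∞) (F : ι → X → ℝ≥0∞) (A : ℝ≥0∞)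
    (hF : ∀ i l, l * μ {x | l < F i x} ≤ A) (l : ℝ≥0∞) :
    l * μ {x | l < ∑' i, s i * s i * F i x} ≤ (∑' i, s i) * (∑' i, s i) * A := by
  set S := ∑' i, s i with hS
  rcases isEmpty_or_nonempty ι with hι | ⟨⟨i₀⟩⟩
  · simp
  have hs_top : ∀ i, s i ≠ ∞ := fun i => ne_top_of_le_ne_top hst (ENNReal.le_tsum i)
  have hS0 : S ≠ 0 := fun h => hs0 i₀ (by simpa using (ENNReal.le_tsum i₀).trans h.le)
  -- If `F i x ≤ l / (S * s i)` for all `i`, the weighted sum is at most `∑ s i * (l / S) = l`. One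
  -- factor `s i` is spent on this, the other on the union bound.
  have hsub : {x | l < ∑' i, s i * s i * F i x} ⊆ ⋃ i, {x | l / (S * s i) < F i x} := by
    intro x hx
    by_contra hcon
    simp only [Set.mem_iUnion, Set.mem_ofPred_eq, not_exists, not_lt] at hcon hx
    refine absurd hx (not_lt.2 ?_)
    calc ∑' i, s i * s i * F i x ≤ ∑' i, s i * (l / S) := by
          refine ENNReal.tsum_le_tsum fun i => ?_
          calc s i * s i * F i x ≤ s i * s i * (l / (S * s i)) := by gcongr; exact hcon i
            _ = s i * (l / S) := by
              rw [ENNReal.div_eq_inv_mul, ENNReal.div_eq_inv_mul,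
                ENNReal.mul_inv (Or.inl hS0) (Or.inl hst)]
              calc s i * s i * (S⁻¹ * (s i)⁻¹ * l) = s i * (S⁻¹ * l) * (s i * (s i)⁻¹) := by ring
                _ = _ := by rw [ENNReal.mul_inv_cancel (hs0 i) (hs_top i), mul_one]
      _ = S * (l / S) := by rw [ENNReal.tsum_mul_right]
      _ = l := ENNReal.mul_div_cancel hS0 hst
  calc l * μ {x | l < ∑' i, s i * s i * F i x} ≤ l * ∑' i, μ {x | l / (S * s i) < F i x} := by
        gcongr
        exact (measure_mono hsub).trans (measure_iUnion_le _)
    _ = ∑' i, l * μ {x | l / (S * s i) < F i x} := ENNReal.tsum_mul_left.symm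
    _ ≤ ∑' i, s i * (S * A) := by
        refine ENNReal.tsum_le_tsum fun i => ?_
        have h0 : S * s i ≠ 0 := mul_ne_zero hS0 (hs0 i)
        have ht : S * s i ≠ ∞ := ENNReal.mul_ne_top hst (hs_top i)
        calc l * μ {x | l / (S * s i) < F i x}
            = (S * s i) * (l / (S * s i) * μ {x | l / (S * s i) < F i x}) := by
              rw [← mul_assoc, ENNReal.mul_div_cancel h0 ht]
          _ ≤ (S * s i) * A := by gcongr; exact hF i _
          _ = _ := by ring
    _ = _ := by rw [ENNReal.tsum_mul_right, mul_assoc]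

lemma tsum_pow_sum_ne_top (m : ℕ) {r : ℝ≥0∞} (hr : r < 1) :
    ∑' a : Fin m → ℕ, r ^ (∑ j, a j) ≠ ∞ := by
  induction m with
  | zero => simp
  | succ m ih =>
    rw [← (Fin.consEquiv fun _ : Fin (m + 1) => ℕ).tsum_eq]
    have : ∀ c : ℕ × (Fin m → ℕ), r ^ (∑ j, (Fin.consEquiv fun _ : Fin (m + 1) => ℕ) c j) =
        r ^ c.1 * r ^ (∑ j, c.2 j) := by
      intro c
      rw [← pow_add, Fin.sum_univ_succ]
      simp [Fin.consEquiv]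
    simp_rw [this]
    rw [ENNReal.tsum_prod']
    simp_rw [ENNReal.tsum_mul_left]
    rw [ENNReal.tsum_mul_right]
    refine ENNReal.mul_ne_top ?_ ih
    rw [ENNReal.tsum_geometric]
    exact ENNReal.inv_ne_top.2 (tsub_pos_of_lt hr).ne'

/-! ### Sheared boxes and the maximal operator of one block -/

instance : IsProbabilityMeasure (volume : Measure UnitAddCircle) := ⟨by simp⟩

instance : Measure.IsNegInvariant (volume : Measure UnitAddCircle) := inferInstance

/-- The shear `y_p ↦ y_p + ∑_{j ≠ p} ε_j y_j` of the torus. -/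
def shear {m : ℕ} (p : Fin m) (ε : Fin m → SignType) :
    (Fin m → UnitAddCircle) →+ (Fin m → UnitAddCircle) where
  toFun y := Function.update y p (y p + ∑ j ∈ Finset.univ.erase p, (ε j : ℤ) • y j)
  map_zero' := by simp
  map_add' y z := by
    have : Function.update (y + z) p ((y + z) p + ∑ j ∈ Finset.univ.erase p, (ε j : ℤ) • (y + z) j)
        = Function.update (y + z) p ((y p + ∑ j ∈ Finset.univ.erase p, (ε j : ℤ) • y j) +
          (z p + ∑ j ∈ Finset.univ.erase p, (ε j : ℤ) • z j)) := by
      congr 1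
      simp only [Pi.add_apply, smul_add, Finset.sum_add_distrib]
      abel
    rw [this, Function.update_add]

section shear
variable {m : ℕ} (p : Fin m) (ε : Fin m → SignType)

lemma shear_apply_self (y : Fin m → UnitAddCircle) :
    shear p ε y p = y p + ∑ j ∈ Finset.univ.erase p, (ε j : ℤ) • y j := by
  simp [shear]

lemma shear_apply_of_ne (y : Fin m → UnitAddCircle) {j : Fin m} (hj : j ≠ p) :
    shear p ε y j = y j := by
  simp [shear, hj]

lemma shear_zero (y : Fin m → UnitAddCircle) : shear p 0 y = y := by
  simp [shear]

lemma continuous_shear : Continuous (shear p ε) := by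
  change Continuous fun y : Fin m → UnitAddCircle =>
    Function.update y p (y p + ∑ j ∈ Finset.univ.erase p, (ε j : ℤ) • y j)
  fun_prop

lemma shear_surjective : Function.Surjective (shear p ε) := by
  intro z
  refine ⟨Function.update z p (z p - ∑ j ∈ Finset.univ.erase p, (ε j : ℤ) • z j), ?_⟩
  ext j
  by_cases hj : j = p
  · subst hj
    rw [shear_apply_self, Function.update_self, sub_add_eq_add_sub, sub_eq_iff_eq_add]
    congr 1
    refine Finset.sum_congr rfl fun i hi => ?_
    rw [Function.update_of_ne (Finset.ne_of_mem_erase hi)]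
  · rw [shear_apply_of_ne _ _ _ hj, Function.update_of_ne hj]

/-- A continuous surjective endomorphism of a compact group preserves normalized Haar measure, so
shearing does not change volumes. -/
lemma measurePreserving_shear : MeasurePreserving (shear p ε) volume volume :=
  AddMonoidHom.measurePreserving (continuous_shear p ε) (shear_surjective p ε) rfl

/-- The sheared box of points `y` with `2 ^ k ‖(shear y)_j‖ ≤ ρ 2 ^ (a_j)` for all `j`. -/
def shearBox (a : Fin m → ℕ) (ρ : ℝ) (k : ℕ) : Set (Fin m → UnitAddCircle) :=
  {y | ∀ j, 2 ^ k * ‖shear p ε y j‖ ≤ ρ * 2 ^ a j}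

lemma measurableSet_shearBox (a : Fin m → ℕ) (ρ : ℝ) (k : ℕ) :
    MeasurableSet (shearBox p ε a ρ k) := by
  have : IsClosed (shearBox p ε a ρ k) := by
    simp only [shearBox, Set.ofPred_forall]
    refine isClosed_iInter fun j => isClosed_le ?_ continuous_const
    exact continuous_const.mul ((continuous_apply j).comp (continuous_shear p ε)).norm
  exact this.measurableSet

lemma volume_shearBox_le (a : Fin m → ℕ) (ρ : ℝ) (k : ℕ) :
    volume (shearBox p ε a ρ k) ≤ ∏ j, ENNReal.ofReal (2 * (ρ * 2 ^ a j / 2 ^ k)) := by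
  have h : shearBox p ε a ρ k = shear p ε ⁻¹' (Set.univ.pi fun j =>
      Metric.closedBall (0 : UnitAddCircle) (ρ * 2 ^ a j / 2 ^ k)) := by
    ext y
    simp only [shearBox, Set.mem_ofPred_eq, Set.mem_preimage, Set.mem_univ_pi,
      mem_closedBall_zero_iff]
    refine forall_congr' fun j => ?_
    rw [le_div_iff₀ (by positivity), mul_comm]
  rw [h, (measurePreserving_shear p ε).measure_preimage
    (MeasurableSet.univ_pi fun j => Metric.isClosed_closedBall.measurableSet).nullMeasurableSet,
    volume_pi_pi]
  refine Finset.prod_le_prod' fun j _ => ?_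
  rw [AddCircle.volume_closedBall]
  exact ENNReal.ofReal_le_ofReal (min_le_right _ _)

end shear

/-- The reciprocal size of the box with sides `2 ^ (a_j) / 2 ^ k`. -/
def boxDensity {m : ℕ} (a : Fin m → ℕ) (k : ℕ) : ℝ := ∏ j, (2 ^ k / 2 ^ a j)

lemma boxDensity_pos {m : ℕ} (a : Fin m → ℕ) (k : ℕ) : 0 < boxDensity a k :=
  Finset.prod_pos fun _ _ => by positivity

/-- The bound is uniform in pivot, signs, eccentricities and scale. Size `ρ = 2` is the one needed
in the covering argument: it contains the differences of points of the box with `ρ = 1`. -/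
lemma boxDensity_mul_volume_le {m : ℕ} (p : Fin m) (ε : Fin m → SignType) (a : Fin m → ℕ)
    (k : ℕ) : ENNReal.ofReal (boxDensity a k) * volume (shearBox p ε a 2 k) ≤ 4 ^ m := by
  calc _ ≤ ENNReal.ofReal (boxDensity a k) * ∏ j, ENNReal.ofReal (2 * (2 * 2 ^ a j / 2 ^ k)) := by
        gcongr; exact volume_shearBox_le p ε a 2 k
    _ = ∏ j : Fin m, ENNReal.ofReal 4 := by
        rw [boxDensity, ENNReal.ofReal_prod_of_nonneg (fun _ _ => by positivity),
          ← Finset.prod_mul_distrib]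
        refine Finset.prod_congr rfl fun j _ => ?_
        rw [← ENNReal.ofReal_mul (by positivity)]
        congr 1
        field_simp
        norm_num
    _ = 4 ^ m := by simp

/-- The indices of the sheared boxes: the pivot and signs of the shear, and the eccentricities. -/
abbrev ShearIndex (m : ℕ) : Type := (Fin m × (Fin m → SignType)) × (Fin m → ℕ)

/-- The normalized indicator function of a sheared box. -/
def shearKernel {m : ℕ} (i : ShearIndex m) (k : ℕ) (y : Fin m → UnitAddCircle) : ℝ≥0∞ :=
  ENNReal.ofReal (boxDensity i.2 k) * (shearBox i.1.1 i.1.2 i.2 1 k).indicator 1 y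

lemma measurable_shearKernel {m : ℕ} (i : ShearIndex m) (k : ℕ) :
    Measurable (shearKernel i k) :=
  (measurable_one.indicator (measurableSet_shearBox _ _ _ _ _)).const_mul _

/-- The maximal function of averages over dilates of one sheared box. -/
def shearMaximal {m : ℕ} (i : ShearIndex m) (g : (Fin m → UnitAddCircle) → ℝ≥0∞)
    (y : Fin m → UnitAddCircle) : ℝ≥0∞ :=
  ⨆ k, ∫⁻ t, shearKernel i k (y - t) * g t

lemma shearMaximal_weak_type {m : ℕ} (i : ShearIndex m)
    (g : (Fin m → UnitAddCircle) → ℝ≥0∞) (l : ℝ≥0∞) :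
    l * volume {y | l < shearMaximal i g y} ≤ 4 ^ m * ∫⁻ t, g t := by
  have h1 : ∀ y, shearMaximal i g y = ⨆ k, ENNReal.ofReal (boxDensity i.2 k) *
      ∫⁻ t in {t | y - t ∈ shearBox i.1.1 i.1.2 i.2 1 k}, g t := by
    intro y
    refine iSup_congr fun k => ?_
    have hm : MeasurableSet {t | y - t ∈ shearBox i.1.1 i.1.2 i.2 1 k} :=
      (measurable_const_sub y) (measurableSet_shearBox _ _ _ _ _)
    rw [← lintegral_indicator hm, ← lintegral_const_mul' _ _ ENNReal.ofReal_ne_top]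
    refine lintegral_congr fun t => ?_
    by_cases ht : y - t ∈ shearBox i.1.1 i.1.2 i.2 1 k <;> simp [shearKernel, ht]
  simp_rw [h1]
  refine weak_type_nested_averages volume (shearBox i.1.1 i.1.2 i.2 1) (shearBox i.1.1 i.1.2 i.2 2)
    (measurableSet_shearBox _ _ _ _) (measurableSet_shearBox _ _ _ _) ?_ ?_ ?_ _ (4 ^ m) (by simp)
    (boxDensity_mul_volume_le _ _ _) g l
  · intro k k' hk y hy j
    refine le_trans ?_ (hy j)
    gcongr
    norm_num
  · intro k j
    simp
  · intro k u hu v hv j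
    rw [map_sub, Pi.sub_apply]
    calc _ ≤ 2 ^ k * (‖shear i.1.1 i.1.2 u j‖ + ‖shear i.1.1 i.1.2 v j‖) := by
          gcongr; exact norm_sub_le _ _
      _ ≤ 2 * 2 ^ i.2 j := by linarith [hu j, hv j]

/-- The square root of the decay rate of the weights in `torusMaximal`. -/
def decayRate (m : ℕ) : ℝ := (1 / 2) ^ (1 / (2 * m : ℝ))

lemma decayRate_pos (m : ℕ) : 0 < decayRate m := by unfold decayRate; positivity

lemma decayRate_lt_one {m : ℕ} (hm : 1 ≤ m) : decayRate m < 1 := by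
  have : (0 : ℝ) < m := by exact_mod_cast hm
  exact Real.rpow_lt_one (by norm_num) (by norm_num) (by positivity)

/-- The weights are powers of `decayRate m * decayRate m` with exponent `∑ a_j ≤ m * max a_j`. This
normalization makes a gain of `2 ^ (-max a_j)` enough to pay for them. -/
lemma decayRate_pow {m : ℕ} (hm : 1 ≤ m) : (decayRate m * decayRate m) ^ m = 1 / 2 := by
  have : (0 : ℝ) < m := by exact_mod_cast hm
  rw [← sq, ← pow_mul, decayRate, ← Real.rpow_natCast, ← Real.rpow_mul (by norm_num)]
  push_cast
  rw [one_div_mul_cancel (by positivity), Real.rpow_one]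

/-- The square roots of the weights in `torusMaximal`. -/
def shearWeight {m : ℕ} (i : ShearIndex m) : ℝ≥0∞ :=
  ENNReal.ofReal (decayRate m) ^ (∑ j, i.2 j)

lemma shearWeight_ne_zero {m : ℕ} (i : ShearIndex m) : shearWeight i ≠ 0 :=
  pow_ne_zero _ (by simpa using decayRate_pos m)

lemma tsum_shearWeight_ne_top {m : ℕ} (hm : 1 ≤ m) : ∑' i : ShearIndex m, shearWeight i ≠ ∞ := by
  rw [ENNReal.tsum_prod', tsum_fintype]
  refine ENNReal.sum_ne_top.2 fun c _ => ?_
  exact tsum_pow_sum_ne_top m (ENNReal.ofReal_lt_one.2 (decayRate_lt_one hm))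

/-- A maximal operator on `𝕋^m` dominating the means of Fourier series. -/
def torusMaximal (m : ℕ) (g : (Fin m → UnitAddCircle) → ℝ≥0∞) (y : Fin m → UnitAddCircle) :
    ℝ≥0∞ :=
  ∑' i : ShearIndex m, shearWeight i * shearWeight i * shearMaximal i g y

/-- The dependence on a parameter is needed for measurability when the operator acts on slices of a
function of several blocks. -/
lemma measurable_torusMaximal_param {m : ℕ} {Z : Type*} [MeasurableSpace Z]
    {H : Z → (Fin m → UnitAddCircle) → ℝ≥0∞} (hH : Measurable (Function.uncurry H))
    {φ : Z → Fin m → UnitAddCircle} (hφ : Measurable φ) :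
    Measurable fun z => torusMaximal m (H z) (φ z) := by
  refine Measurable.tsum fun i => Measurable.const_mul (Measurable.iSup fun k => ?_) _
  refine Measurable.lintegral_prod_right' (f := fun q : Z × (Fin m → UnitAddCircle) =>
    shearKernel i k (φ q.1 - q.2) * H q.1 q.2) ?_
  exact ((measurable_shearKernel i k).comp ((hφ.comp measurable_fst).sub measurable_snd)).mul hH

lemma isMaximalOperator_torusMaximal {m : ℕ} (hm : 1 ≤ m) :
    ∃ b C, C ≠ ∞ ∧ IsMaximalOperator volume (torusMaximal m) b C := by
  set W := ∑' i : ShearIndex m, shearWeight i with hW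
  have hWt : W ≠ ∞ := tsum_shearWeight_ne_top hm
  have hWW : ∑' i : ShearIndex m, shearWeight i * shearWeight i ≤ W := by
    refine ENNReal.tsum_le_tsum fun i => ?_
    calc shearWeight i * shearWeight i ≤ shearWeight i * 1 := by
          gcongr
          exact pow_le_one₀ zero_le (ENNReal.ofReal_le_one.2 (decayRate_lt_one hm).le)
      _ = _ := mul_one _
  obtain ⟨b, hb⟩ : ∃ b : ℕ, W * 4 ^ m ≤ 2 ^ b := by
    obtain ⟨n, hn⟩ := ENNReal.exists_nat_gt
      (ENNReal.mul_ne_top hWt (ENNReal.pow_ne_top (by simp)) : W * 4 ^ m ≠ ∞)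
    exact ⟨n, hn.le.trans (by exact_mod_cast (Nat.lt_two_pow_self (n := n)).le)⟩
  refine ⟨b, W * W * 4 ^ m, ENNReal.mul_ne_top (ENNReal.mul_ne_top hWt hWt)
    (ENNReal.pow_ne_top (by simp)), ?_⟩
  refine ⟨?_, ?_, ?_, ?_⟩
  · intro g h hgh y
    unfold torusMaximal shearMaximal
    gcongr with i k t
    exact hgh t
  · intro g hg
    exact measurable_torusMaximal_param (Z := Fin m → UnitAddCircle) (H := fun _ => g)
      (hg.comp measurable_snd) measurable_id
  · intro g hg c y
    have hmax : ∀ i : ShearIndex m, shearMaximal i (fun y => g y + c) y ≤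
        shearMaximal i g y + 4 ^ m * c := by
      intro i
      refine iSup_le fun k => ?_
      have hk : Measurable fun t => shearKernel i k (y - t) :=
        (measurable_shearKernel i k).comp (measurable_const_sub y)
      simp_rw [mul_add]
      have hkg : Measurable fun t => shearKernel i k (y - t) * g t := hk.mul hg
      rw [lintegral_add_left hkg, lintegral_mul_const _ hk]
      gcongr
      · exact le_iSup (fun k => ∫⁻ t, shearKernel i k (y - t) * g t) k
      -- The kernel has mass at most `4 ^ m`, by enlarging the box from `ρ = 1` to `ρ = 2`.
      · rw [lintegral_sub_left_eq_self (shearKernel i k) y]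
        unfold shearKernel
        rw [lintegral_const_mul _ (measurable_one.indicator (measurableSet_shearBox _ _ _ _ _)),
          lintegral_indicator_one (measurableSet_shearBox _ _ _ _ _)]
        refine le_trans ?_ (boxDensity_mul_volume_le i.1.1 i.1.2 i.2 k)
        gcongr
        intro y hy j
        refine (hy j).trans ?_
        gcongr
        norm_num
    calc torusMaximal m (fun y => g y + c) y
        ≤ ∑' i : ShearIndex m, (shearWeight i * shearWeight i * shearMaximal i g y +
            shearWeight i * shearWeight i * (4 ^ m * c)) := by
          refine ENNReal.tsum_le_tsum fun i => ?_
          rw [← mul_add]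
          gcongr
          exact hmax i
      _ = torusMaximal m g y +
          (∑' i : ShearIndex m, shearWeight i * shearWeight i) * (4 ^ m * c) := by
          rw [ENNReal.tsum_add, ENNReal.tsum_mul_right, torusMaximal]
      _ ≤ torusMaximal m g y + W * (4 ^ m * c) := by gcongr
      _ = torusMaximal m g y + W * 4 ^ m * c := by rw [mul_assoc]
      _ ≤ torusMaximal m g y + 2 ^ b * c := by gcongr
  · intro g hg l
    rw [mul_assoc (W * W)]
    exact weak_type_tsum shearWeight shearWeight_ne_zero hWt (fun i => shearMaximal i g)
      (4 ^ m * ∫⁻ t, g t) (fun i l => shearMaximal_weak_type i g l) l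

/-! ### Operators acting on one coordinate of a product -/

section product
variable {ι : Type*} [DecidableEq ι] {Y : ι → Type*} [∀ i, MeasureSpace (Y i)]
  [∀ i, IsProbabilityMeasure (volume : Measure (Y i))]

/-- Averaging over one coordinate does not change the integral. -/
lemma lintegral_lintegral_update [Fintype ι] (i : ι) {F : (∀ i, Y i) → ℝ≥0∞} (hF : Measurable F) :
    ∫⁻ x, ∫⁻ s, F (Function.update x i s) = ∫⁻ x, F x := by
  refine lintegral_eq_of_lmarginal_eq (μ := fun i => (volume : Measure (Y i))) {i} ?_ hF ?_
  · exact Measurable.lintegral_prod_right'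
      (f := fun q : (∀ i, Y i) × Y i => F (Function.update q.1 i q.2))
      (hF.comp measurable_update')
  · ext x
    simp [lmarginal_singleton]

/-- The action of an operator on functions of the `i`-th coordinate on functions of all
coordinates. -/
def coordOp (i : ι) (T : (Y i → ℝ≥0∞) → Y i → ℝ≥0∞) (h : (∀ i, Y i) → ℝ≥0∞) (x : ∀ i, Y i) :
    ℝ≥0∞ :=
  T (fun s => h (Function.update x i s)) (x i)

/-- The weak type bound is applied on each slice and integrated over the other coordinates by
Fubini. Joint measurability is a separate hypothesis because the slicewise property does not provide
it. -/
lemma isMaximalOperator_coordOp [Fintype ι] (i : ι) {T : (Y i → ℝ≥0∞) → Y i → ℝ≥0∞} {b : ℕ} {C : ℝ≥0∞}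
    (hT : IsMaximalOperator volume T b C)
    (hmeas : ∀ h : (∀ i, Y i) → ℝ≥0∞, Measurable h → Measurable (coordOp i T h)) :
    IsMaximalOperator volume (coordOp i T) b C where
  mono g h hgh x := hT.mono (fun s => hgh _) _
  measurable g hg := hmeas g hg
  add_const g hg c x := hT.add_const (hg.comp (measurable_update x)) c _
  weak_type g hg l := by
    have hset : MeasurableSet {x | l < coordOp i T g x} :=
      measurableSet_lt measurable_const (hmeas g hg)
    rw [← lintegral_indicator_one hset,
      ← lintegral_lintegral_update i (measurable_one.indicator hset),
      ← lintegral_lintegral_update i hg]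
    have hm1 : Measurable fun x : ∀ i, Y i =>
        ∫⁻ s, {x | l < coordOp i T g x}.indicator 1 (Function.update x i s) :=
      Measurable.lintegral_prod_right' (f := fun q : (∀ i, Y i) × Y i =>
        {x | l < coordOp i T g x}.indicator (1 : (∀ i, Y i) → ℝ≥0∞) (Function.update q.1 i q.2))
        ((measurable_one.indicator hset).comp measurable_update')
    have hm2 : Measurable fun x : ∀ i, Y i => ∫⁻ s, g (Function.update x i s) :=
      Measurable.lintegral_prod_right' (f := fun q : (∀ i, Y i) × Y i =>
        g (Function.update q.1 i q.2)) (hg.comp measurable_update')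
    rw [← lintegral_const_mul _ hm1, ← lintegral_const_mul _ hm2]
    refine lintegral_mono fun x => ?_
    have hgx : Measurable fun s => g (Function.update x i s) := hg.comp (measurable_update x)
    refine le_trans (le_of_eq ?_) (hT.weak_type hgx l)
    rw [← lintegral_indicator_one (measurableSet_lt measurable_const (hT.measurable hgx))]
    congr 1
    refine lintegral_congr fun s => ?_
    simp [Set.indicator, coordOp]

/-- If `T i` dominates the integral operator with kernel `κ i`, then the composition of the
`T i` dominates the integral operator with the product kernel. -/
lemma lmarginal_prod_le_iterOp {κ : ∀ i, Y i → Y i → ℝ≥0∞}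
    (hκ : ∀ i, Measurable (Function.uncurry (κ i))) {T : ∀ i, (Y i → ℝ≥0∞) → Y i → ℝ≥0∞}
    (hκT : ∀ i (g : Y i → ℝ≥0∞), Measurable g → ∀ y, ∫⁻ t, κ i y t * g t ≤ T i g y)
    (hmeas : ∀ i (h : (∀ i, Y i) → ℝ≥0∞), Measurable h → Measurable (coordOp i (T i) h))
    {h : (∀ i, Y i) → ℝ≥0∞} (hh : Measurable h) {l : List ι} (hl : l.Nodup) (x : ∀ i, Y i) :
    (lmarginal (fun _ => volume) l.toFinset fun t => (∏ i ∈ l.toFinset, κ i (x i) (t i)) * h t) x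
      ≤ iterOp (fun i => coordOp i (T i)) l h x := by
  induction l generalizing x with
  | nil => simp
  | cons i l ih =>
    have hil : i ∉ l.toFinset := by simpa using (List.nodup_cons.1 hl).1
    have hκm : ∀ (j : ι) (z : Y j), Measurable (κ j z) := fun j z => (hκ j).of_uncurry_left
    have hprod : ∀ (s : Finset ι) (z : ∀ i, Y i),
        Measurable fun t : ∀ i, Y i => (∏ j ∈ s, κ j (z j) (t j)) * h t := fun s z =>
      (Finset.measurable_prod s fun j _ => (hκm j _).comp (measurable_pi_apply j)).mul hh
    have hiter : Measurable (iterOp (fun i => coordOp i (T i)) l h) := by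
      clear ih hl hil
      induction l with
      | nil => exact hh
      | cons j l ih => exact hmeas j _ ih
    rw [List.toFinset_cons, lmarginal_insert _ (hprod _ x) hil, iterOp_cons]
    refine le_trans (lintegral_mono fun s => ?_)
      (hκT i (fun s => iterOp (fun i => coordOp i (T i)) l h (Function.update x i s))
        (hiter.comp (measurable_update x)) (x i))
    refine le_trans (le_of_eq ?_) (mul_le_mul_right
      (ih (List.nodup_cons.1 hl).2 (Function.update x i s)) (κ i (x i) s))
    -- As `i` is not in `l`, moving the `i`-th coordinate to `s` leaves the remaining kernels
    -- unchanged.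
    have hcongr : ∀ t : ∀ i, Y i, ∏ j ∈ l.toFinset, κ j (Function.update x i s j) (t j) =
        ∏ j ∈ l.toFinset, κ j (x j) (t j) := fun t =>
      Finset.prod_congr rfl fun j hj => by
        rw [Function.update_of_ne (ne_of_mem_of_not_mem hj hil)]
    unfold lmarginal
    rw [← lintegral_const_mul]
    · refine lintegral_congr fun y => ?_
      simp only [hcongr, Finset.prod_insert hil, mul_assoc]
      congr 2
      simp [Function.updateFinset, hil]
    · exact (hprod _ _).comp measurable_updateFinset

end product

/-! ### One-dimensional kernels: Dirichlet, Fejér, Poisson -/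

lemma fourier_eq_zpow (n : ℤ) (t : UnitAddCircle) :
    fourier n t = (fourier 1 t : ℂ) ^ n := by
  simp [fourier_apply, AddCircle.toCircle_zsmul]

lemma fourier_ne_zero (n : ℤ) (t : UnitAddCircle) : (fourier n t : ℂ) ≠ 0 := by
  simp [fourier_apply]

lemma norm_fourier_apply (n : ℤ) (t : UnitAddCircle) : ‖(fourier n t : ℂ)‖ = 1 :=
  Circle.norm_coe _

/-- The chord `|e^{2πit} - 1|` is at least `4 ‖t‖`. -/
lemma four_mul_norm_le (t : UnitAddCircle) : 4 * ‖t‖ ≤ ‖(fourier 1 t : ℂ) - 1‖ := by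
  obtain ⟨x, rfl⟩ : ∃ x : ℝ, (x : UnitAddCircle) = t := QuotientAddGroup.mk_surjective t
  have hround : ((x - round x : ℝ) : UnitAddCircle) = x := by
    have h : ((round x : ℝ) : UnitAddCircle) = 0 := by
      rw [← mul_one (round x : ℝ), ← zsmul_eq_mul, AddCircle.coe_zsmul, AddCircle.coe_period,
        smul_zero]
    rw [AddCircle.coe_sub, h, sub_zero]
  rw [UnitAddCircle.norm_eq, ← hround, fourier_coe_apply]
  set u : ℝ := x - round x with hu
  have hu2 : |u| ≤ 1 / 2 := abs_sub_round x
  have hexp : (2 * Real.pi * Complex.I * (1 : ℤ) * u / (1 : ℝ) : ℂ) =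
      Complex.I * ((2 * Real.pi * u : ℝ) : ℂ) := by
    push_cast; ring
  rw [hexp, Complex.norm_exp_I_mul_ofReal_sub_one, norm_mul, Real.norm_eq_abs, Real.norm_eq_abs]
  have hsin : 2 / Real.pi * |Real.pi * u| ≤ |Real.sin (Real.pi * u)| := by
    refine Real.mul_abs_le_abs_sin ?_
    rw [abs_mul, abs_of_pos Real.pi_pos]
    nlinarith [Real.pi_pos]
  rw [abs_mul, abs_of_pos Real.pi_pos] at hsin
  have hpi : 2 / Real.pi * (Real.pi * |u|) = 2 * |u| := by
    field_simp
  have h2 : 2 * Real.pi * u / 2 = Real.pi * u := by ring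
  rw [h2, abs_two]
  linarith

lemma dirichletKernel_succ (l : ℕ) (t : UnitAddCircle) :
    dirichletKernel (l + 1) t =
      dirichletKernel l t + (fourier (l + 1 : ℤ) t + fourier (-(l + 1) : ℤ) t) := by
  have h : Finset.Icc (-((l + 1 : ℕ) : ℤ)) ((l + 1 : ℕ) : ℤ) =
      insert (l + 1 : ℤ) (insert (-(l + 1) : ℤ) (Finset.Icc (-(l : ℤ)) (l : ℤ))) := by
    ext k
    simp only [Finset.mem_Icc, Finset.mem_insert]
    push_cast
    omega
  rw [dirichletKernel, h, Finset.sum_insert, Finset.sum_insert, dirichletKernel]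
  · ring
  · simp
  · simp only [Finset.mem_insert, Finset.mem_Icc]
    omega

lemma dirichletKernel_zero (t : UnitAddCircle) : dirichletKernel 0 t = 1 := by
  simp [dirichletKernel]

lemma norm_dirichletKernel_succ_sub_le (l : ℕ) (t : UnitAddCircle) :
    ‖dirichletKernel (l + 1) t - dirichletKernel l t‖ ≤ 2 := by
  rw [dirichletKernel_succ, add_sub_cancel_left]
  refine (norm_add_le _ _).trans ?_
  rw [norm_fourier_apply, norm_fourier_apply]
  norm_num

lemma norm_dirichletKernel_le (l : ℕ) (t : UnitAddCircle) :
    ‖dirichletKernel l t‖ ≤ 2 * l + 1 := by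
  induction l with
  | zero => simp [dirichletKernel_zero]
  | succ l ih =>
    have h := norm_dirichletKernel_succ_sub_le l t
    have h2 := norm_le_norm_add_norm_sub' (dirichletKernel (l + 1) t) (dirichletKernel l t)
    push_cast
    linarith

/-- Telescoping leaves just two pure powers of `e^{2πit}`; the expansion of the Marcinkiewicz kernel
rests on this. -/
lemma dirichletKernel_mul (l : ℕ) (t : UnitAddCircle) :
    dirichletKernel l t * (fourier 1 t - 1) =
      (fourier 1 t : ℂ) ^ (l + 1) - ((fourier 1 t : ℂ)⁻¹) ^ l := by
  induction l with
  | zero => simp [dirichletKernel_zero]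
  | succ l ih =>
    have hz := fourier_ne_zero 1 t
    rw [dirichletKernel_succ, add_mul, ih, fourier_eq_zpow (l + 1), fourier_eq_zpow (-(l + 1)),
      zpow_neg]
    generalize (fourier 1 t : ℂ) = z at hz ⊢
    have hcast : z ^ ((l : ℤ) + 1) = z ^ (l + 1) := by
      exact_mod_cast zpow_natCast z (l + 1)
    rw [hcast, ← inv_pow]
    linear_combination z⁻¹ ^ l * inv_mul_cancel₀ hz

lemma norm_fejerKernel_le (n : ℕ) (t : UnitAddCircle) : ‖fejerKernel n t‖ ≤ 2 * (n + 1) := by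
  have hn : (0 : ℝ) < n + 1 := by positivity
  have hn' : ‖((n : ℂ) + 1)⁻¹‖ = ((n : ℝ) + 1)⁻¹ := by
    rw [norm_inv]; congr 1; exact_mod_cast Complex.norm_natCast (n + 1)
  rw [fejerKernel, norm_mul, hn', inv_mul_le_iff₀ hn]
  refine (norm_sum_le _ _).trans ?_
  calc ∑ l ∈ Finset.range (n + 1), ‖dirichletKernel l t‖
      ≤ ∑ l ∈ Finset.range (n + 1), (2 * ((n : ℝ) + 1)) := by
        refine Finset.sum_le_sum fun l hl => (norm_dirichletKernel_le l t).trans ?_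
        have : (l : ℝ) ≤ n := by exact_mod_cast Nat.lt_succ_iff.1 (Finset.mem_range.1 hl)
        linarith
    _ = _ := by rw [Finset.sum_const, Finset.card_range, nsmul_eq_mul]; push_cast; ring

/-- A second telescoping. The right side has norm at most 4, which gives the quadratic decay of the
Fejér kernel. -/
lemma sum_dirichletKernel_mul (n : ℕ) (t : UnitAddCircle) :
    (∑ l ∈ Finset.range (n + 1), dirichletKernel l t) * (fourier 1 t - 1) ^ 2 =
      (fourier 1 t : ℂ) ^ (n + 2) - 2 * fourier 1 t + ((fourier 1 t : ℂ)⁻¹) ^ n := by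
  have hz := fourier_ne_zero 1 t
  induction n with
  | zero => simp [dirichletKernel_zero]; ring
  | succ n ih =>
    rw [Finset.sum_range_succ, add_mul, ih, sq, ← mul_assoc, dirichletKernel_mul]
    generalize (fourier 1 t : ℂ) = z at hz ⊢
    linear_combination -z⁻¹ ^ n * inv_mul_cancel₀ hz

lemma norm_fejerKernel_mul_le (n : ℕ) (t : UnitAddCircle) :
    ‖fejerKernel n t‖ * ((n + 1) * ‖t‖ ^ 2) ≤ 2 := by
  have hn : (0 : ℝ) < n + 1 := by positivity
  have hn' : ‖((n : ℂ) + 1)⁻¹‖ = ((n : ℝ) + 1)⁻¹ := by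
    rw [norm_inv]; congr 1; exact_mod_cast Complex.norm_natCast (n + 1)
  have h1 := congrArg norm (sum_dirichletKernel_mul n t)
  rw [norm_mul, norm_pow] at h1
  have h2 : ‖(fourier 1 t : ℂ) ^ (n + 2) - 2 * fourier 1 t + ((fourier 1 t : ℂ)⁻¹) ^ n‖ ≤ 4 := by
    refine (norm_add_le _ _).trans ?_
    have := norm_sub_le ((fourier 1 t : ℂ) ^ (n + 2)) (2 * fourier 1 t)
    rw [norm_mul, norm_pow, norm_fourier_apply, Complex.norm_two] at this
    rw [norm_pow, norm_inv, norm_fourier_apply]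
    norm_num at this ⊢
    linarith
  have h3 : (4 * ‖t‖) ^ 2 ≤ ‖(fourier 1 t : ℂ) - 1‖ ^ 2 :=
    pow_le_pow_left₀ (by positivity) (four_mul_norm_le t) 2
  rw [fejerKernel, norm_mul, hn']
  set A := ‖∑ l ∈ Finset.range (n + 1), dirichletKernel l t‖ with hA
  have hA0 : 0 ≤ A := norm_nonneg _
  have h4 : A * (4 * ‖t‖) ^ 2 ≤ 4 := by
    calc _ ≤ A * ‖(fourier 1 t : ℂ) - 1‖ ^ 2 := by gcongr
      _ ≤ 4 := by rw [h1]; exact h2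
  calc ((n : ℝ) + 1)⁻¹ * A * ((n + 1) * ‖t‖ ^ 2) = A * ‖t‖ ^ 2 := by field_simp
    _ ≤ 2 := by nlinarith

lemma poissonKernel_eq {r : ℝ} (h0 : 0 ≤ r) (h1 : r < 1) (t : UnitAddCircle) :
    poissonKernel r t = (1 - r * fourier 1 t)⁻¹ +
      r * (fourier 1 t : ℂ)⁻¹ * (1 - r * (fourier 1 t : ℂ)⁻¹)⁻¹ := by
  have hz := fourier_ne_zero 1 t
  have hn1 : ‖(r : ℂ) * fourier 1 t‖ < 1 := by
    rw [norm_mul, norm_fourier_apply, mul_one, Complex.norm_real, Real.norm_of_nonneg h0]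
    exact h1
  have hn2 : ‖(r : ℂ) * (fourier 1 t : ℂ)⁻¹‖ < 1 := by
    rw [norm_mul, norm_inv, norm_fourier_apply, inv_one, mul_one, Complex.norm_real,
      Real.norm_of_nonneg h0]
    exact h1
  have hs1 := hasSum_geometric_of_norm_lt_one hn1
  have hs2 := (hasSum_geometric_of_norm_lt_one hn2).mul_left ((r : ℂ) * (fourier 1 t : ℂ)⁻¹)
  refine (HasSum.of_nat_of_neg_add_one (f := fun k : ℤ => (r : ℂ) ^ k.natAbs * fourier k t)
    ?_ ?_).tsum_eq
  · refine (congrArg (HasSum · _) (funext fun n => ?_)).mpr hs1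
    rw [fourier_eq_zpow, mul_pow]
    simp
  · refine (congrArg (HasSum · _) (funext fun n => ?_)).mpr hs2
    have : (-((n : ℤ) + 1)).natAbs = n + 1 := by omega
    rw [fourier_eq_zpow, this, zpow_neg, ← pow_succ', mul_pow, inv_pow]
    congr 2


/-- This is the closed form `P_r = (1 - r²) / |1 - r z|²` with `z = e^{2πit}`. Both the size and the
decay of the kernel follow from lower bounds for `|1 - r z|`. -/
lemma norm_poissonKernel_mul_sq {r : ℝ} (h0 : 0 ≤ r) (h1 : r < 1) (t : UnitAddCircle) :
    ‖poissonKernel r t‖ * ‖1 - (r : ℂ) * fourier 1 t‖ ^ 2 = 1 - r ^ 2 := by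
  have hz := fourier_ne_zero 1 t
  have hconj : ‖1 - (r : ℂ) * (fourier 1 t : ℂ)⁻¹‖ = ‖1 - (r : ℂ) * fourier 1 t‖ := by
    have : (fourier 1 t : ℂ)⁻¹ = (starRingEnd ℂ) (fourier 1 t) := by
      rw [← fourier_neg, fourier_eq_zpow (-1), zpow_neg_one]
    rw [this, ← Complex.norm_conj]
    simp
  have hne : 1 - (r : ℂ) * fourier 1 t ≠ 0 := by
    intro h
    have := congrArg norm (sub_eq_zero.1 h)
    rw [norm_mul, norm_fourier_apply, mul_one, Complex.norm_real, Real.norm_of_nonneg h0,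
      norm_one] at this
    linarith
  have hne' : 1 - (r : ℂ) * (fourier 1 t : ℂ)⁻¹ ≠ 0 := by
    rw [← norm_ne_zero_iff, hconj, norm_ne_zero_iff]; exact hne
  have hkey : poissonKernel r t * ((1 - r * fourier 1 t) * (1 - r * (fourier 1 t : ℂ)⁻¹)) =
      ((1 - r ^ 2 : ℝ) : ℂ) := by
    rw [poissonKernel_eq h0 h1]
    push_cast
    generalize (fourier 1 t : ℂ) = z at hz hne hne' ⊢
    calc _ = (1 - r * z)⁻¹ * (1 - r * z) * (1 - r * z⁻¹) +
          r * z⁻¹ * ((1 - r * z⁻¹)⁻¹ * (1 - r * z⁻¹)) * (1 - r * z) := by ring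
      _ = 1 - (r : ℂ) ^ 2 * (z⁻¹ * z) := by
          rw [inv_mul_cancel₀ hne, inv_mul_cancel₀ hne']; ring
      _ = _ := by rw [inv_mul_cancel₀ hz, mul_one]
  have := congrArg norm hkey
  rw [norm_mul, norm_mul, hconj, Complex.norm_real, Real.norm_of_nonneg (by nlinarith)] at this
  rw [sq ‖_‖]
  exact this

lemma norm_poissonKernel_le {r : ℝ} (h0 : 0 ≤ r) (h1 : r < 1) (t : UnitAddCircle) :
    ‖poissonKernel r t‖ ≤ 2 * (1 - r)⁻¹ := by
  have h := norm_poissonKernel_mul_sq h0 h1 t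
  have hge : 1 - r ≤ ‖1 - (r : ℂ) * fourier 1 t‖ := by
    have := norm_sub_norm_le (1 : ℂ) ((r : ℂ) * fourier 1 t)
    rwa [norm_mul, norm_fourier_apply, mul_one, Complex.norm_real, Real.norm_of_nonneg h0,
      norm_one] at this
  have hpos : 0 < 1 - r := by linarith
  rw [← div_eq_mul_inv, le_div_iff₀ hpos]
  have h2 : ‖poissonKernel r t‖ * (1 - r) ^ 2 ≤ 1 - r ^ 2 := by
    rw [← h]; gcongr
  have h3 : (‖poissonKernel r t‖ * (1 - r)) * (1 - r) ≤ (1 + r) * (1 - r) := by nlinarith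
  have := le_of_mul_le_mul_right h3 hpos
  linarith

lemma norm_poissonKernel_mul_le {r : ℝ} (h0 : 0 ≤ r) (h1 : r < 1) (t : UnitAddCircle) :
    ‖poissonKernel r t‖ * ((1 - r)⁻¹ * ‖t‖ ^ 2) ≤ 2 := by
  have h := norm_poissonKernel_mul_sq h0 h1 t
  have hpos : 0 < 1 - r := by linarith
  have hge : 1 - r ≤ ‖1 - (r : ℂ) * fourier 1 t‖ := by
    have := norm_sub_norm_le (1 : ℂ) ((r : ℂ) * fourier 1 t)
    rwa [norm_mul, norm_fourier_apply, mul_one, Complex.norm_real, Real.norm_of_nonneg h0,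
      norm_one] at this
  -- From `4‖t‖ ≤ |z - 1| ≤ |1 - r z| + (1 - r) ≤ 2 |1 - r z|`.
  have hge2 : 2 * ‖t‖ ≤ ‖1 - (r : ℂ) * fourier 1 t‖ := by
    have h3 : ‖(fourier 1 t : ℂ) - 1‖ ≤ ‖1 - (r : ℂ) * fourier 1 t‖ + (1 - r) := by
      have : (fourier 1 t : ℂ) - 1 = -(1 - (r : ℂ) * fourier 1 t) +
          ((1 - r : ℝ) : ℂ) * fourier 1 t := by push_cast; ring
      rw [this]
      refine (norm_add_le _ _).trans ?_
      rw [norm_neg, norm_mul, norm_fourier_apply, mul_one, Complex.norm_real,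
        Real.norm_of_nonneg hpos.le]
    have := four_mul_norm_le t
    linarith
  have h2 : ‖poissonKernel r t‖ * (2 * ‖t‖) ^ 2 ≤ 1 - r ^ 2 := by
    rw [← h]; gcongr
  calc ‖poissonKernel r t‖ * ((1 - r)⁻¹ * ‖t‖ ^ 2)
      = (1 - r)⁻¹ * (‖poissonKernel r t‖ * ‖t‖ ^ 2) := by ring
    _ ≤ 2 := by
        rw [inv_mul_le_iff₀ hpos]
        nlinarith

/-! ### Domination of kernels by sheared boxes -/

/-- A kernel on `𝕋^m` bounded, at a common dyadic scale, by weighted indicators of sheared boxes. -/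
def IsBoxDominated {m : ℕ} (c : ℝ) (K : (Fin m → UnitAddCircle) → ℂ) : Prop :=
  ∃ k : ℕ, ∀ y, ∃ i : ShearIndex m, y ∈ shearBox i.1.1 i.1.2 i.2 1 k ∧
    ‖K y‖ ≤ c * (decayRate m * decayRate m) ^ (∑ j, i.2 j) * boxDensity i.2 k

lemma IsBoxDominated.mono {m : ℕ} {c c' : ℝ} (hc : c ≤ c') {K : (Fin m → UnitAddCircle) → ℂ}
    (hK : IsBoxDominated c K) : IsBoxDominated c' K := by
  obtain ⟨k, hk⟩ := hK
  refine ⟨k, fun y => ?_⟩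
  obtain ⟨i, hi, hle⟩ := hk y
  refine ⟨i, hi, hle.trans ?_⟩
  have := (decayRate_pos m).le
  have := (boxDensity_pos i.2 k).le
  gcongr

/-- The weighted sum of the normalized indicators of sheared boxes at scale `2 ^ k`. -/
def torusKernel (m k : ℕ) (y : Fin m → UnitAddCircle) : ℝ≥0∞ :=
  ∑' i : ShearIndex m, shearWeight i * shearWeight i * shearKernel i k y

lemma measurable_torusKernel (m k : ℕ) : Measurable (torusKernel m k) :=
  Measurable.tsum fun i => (measurable_shearKernel i k).const_mul _

lemma lintegral_torusKernel_mul_le (m k : ℕ) {g : (Fin m → UnitAddCircle) → ℝ≥0∞}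
    (hg : Measurable g) (y : Fin m → UnitAddCircle) :
    ∫⁻ t, torusKernel m k (y - t) * g t ≤ torusMaximal m g y := by
  unfold torusKernel torusMaximal
  simp_rw [← ENNReal.tsum_mul_right]
  have hm : ∀ i : ShearIndex m, Measurable fun t => shearKernel i k (y - t) * g t := fun i =>
    ((measurable_shearKernel i k).comp (measurable_const_sub y)).mul hg
  rw [lintegral_tsum]
  · refine ENNReal.tsum_le_tsum fun i => ?_
    simp_rw [mul_assoc]
    rw [lintegral_const_mul _ ((hm i).const_mul _), lintegral_const_mul _ (hm i)]
    gcongr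
    exact le_iSup (fun k => ∫⁻ t, shearKernel i k (y - t) * g t) k
  · intro i
    simp_rw [mul_assoc]
    exact (((hm i).const_mul _).const_mul _).aemeasurable

/-- One term of the sum `torusKernel` suffices at each point, so the box may depend on the point as
long as the scale `k` does not. -/
lemma IsBoxDominated.enorm_le {m : ℕ} {c : ℝ} (hc : 0 ≤ c) {K : (Fin m → UnitAddCircle) → ℂ}
    (hK : IsBoxDominated c K) : ∃ k, ∀ y, ‖K y‖ₑ ≤ ENNReal.ofReal c * torusKernel m k y := by
  obtain ⟨k, hk⟩ := hK
  refine ⟨k, fun y => ?_⟩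
  obtain ⟨i, hi, hle⟩ := hk y
  have hr := (decayRate_pos m).le
  calc ‖K y‖ₑ = ENNReal.ofReal ‖K y‖ := (ofReal_norm _).symm
    _ ≤ ENNReal.ofReal (c * (decayRate m * decayRate m) ^ (∑ j, i.2 j) * boxDensity i.2 k) :=
        ENNReal.ofReal_le_ofReal hle
    _ = ENNReal.ofReal c * (shearWeight i * shearWeight i * shearKernel i k y) := by
        rw [shearKernel, Set.indicator_of_mem hi, shearWeight, ENNReal.ofReal_mul (by positivity),
          ENNReal.ofReal_mul hc, mul_pow, ENNReal.ofReal_mul (by positivity),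
          ENNReal.ofReal_pow hr, Pi.one_apply, mul_one]
        ring
    _ ≤ ENNReal.ofReal c * torusKernel m k y := by
        gcongr
        exact ENNReal.le_tsum i

lemma half_le_decayRate_sq {m : ℕ} (hm : 1 ≤ m) : 1 / 2 ≤ decayRate m * decayRate m := by
  rw [← decayRate_pow hm]
  have h0 := decayRate_pos m
  have h1 := decayRate_lt_one hm
  exact pow_le_of_le_one (by positivity) (by nlinarith) (by omega)

/-- A quantity bounded by `c 2 ^ (-a_j)` for all `j` is bounded by the weight of `a`. -/
lemma le_decayRate_pow {m : ℕ} (hm : 1 ≤ m) {v c : ℝ} (hc : 0 ≤ c) (a : Fin m → ℕ)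
    (hv : ∀ j, v ≤ c / 2 ^ a j) : v ≤ c * (decayRate m * decayRate m) ^ (∑ j, a j) := by
  have : Nonempty (Fin m) := ⟨⟨0, hm⟩⟩
  obtain ⟨p, hp⟩ := Finite.exists_max a
  have h0 := decayRate_pos m
  have h1 := decayRate_lt_one hm
  have hsum : ∑ j, a j ≤ m * a p := by
    calc ∑ j, a j ≤ ∑ _j : Fin m, a p := Finset.sum_le_sum fun j _ => hp j
      _ = m * a p := by simp
  calc v ≤ c / 2 ^ a p := hv p
    _ = c * (decayRate m * decayRate m) ^ (m * a p) := by
        rw [pow_mul, decayRate_pow hm, div_pow, one_pow, div_eq_mul_one_div]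
    _ ≤ _ := by
        gcongr c * ?_
        exact pow_le_pow_of_le_one (by positivity) (by nlinarith) hsum

/-- The dyadic size of a nonnegative number, from above. -/
lemma exists_two_pow_ge (s : ℝ) : ∃ a : ℕ, s ≤ 2 ^ a ∧ (2 : ℝ) ^ a ≤ max 1 (2 * s) := by
  rcases le_or_gt s 1 with h | h
  · exact ⟨0, by simpa using h, by simp⟩
  · obtain ⟨n, h1, h2⟩ := exists_nat_pow_near h.le one_lt_two
    refine ⟨n + 1, h2.le, le_trans ?_ (le_max_right _ _)⟩
    rw [pow_succ]; linarith

/-- Products of one-dimensional kernels of comparable scales with quadratic decay are dominated. -/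
lemma isBoxDominated_prod {m : ℕ} (hm : 1 ≤ m) {c C : ℝ} (hc : 0 ≤ c) (hC : 1 ≤ C)
    {N : Fin m → ℝ} (hN : ∀ j, 1 ≤ N j) (hNC : ∀ j l, N j ≤ C * N l)
    {κ : Fin m → UnitAddCircle → ℂ} (h1 : ∀ j t, ‖κ j t‖ ≤ c * N j)
    (h2 : ∀ j t, ‖κ j t‖ * (N j * ‖t‖ ^ 2) ≤ c) :
    IsBoxDominated ((8 * c * C) ^ m) fun y => ∏ j, κ j (y j) := by
  set p : Fin m := ⟨0, hm⟩
  obtain ⟨k, hk1, hk2⟩ := exists_nat_pow_near (hN p) one_lt_two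
  have hC0 : 0 < C := by linarith
  refine ⟨k, fun y => ?_⟩
  choose a ha1 ha2 using fun j => exists_two_pow_ge (2 ^ k * ‖y j‖)
  -- Zero signs make the shear the identity, so the pivot only fixes the scale.
  refine ⟨((p, 0), a), fun j => by simpa [shear_zero] using ha1 j, ?_⟩
  have hκ : ∀ j, ‖κ j (y j)‖ ≤ 8 * c * C * (1 / 2) ^ a j * (2 ^ k / 2 ^ a j) := by
    intro j
    have hup : N j ≤ 2 * C * 2 ^ k := by
      have : N p ≤ 2 * 2 ^ k := by rw [pow_succ] at hk2; linarith
      calc N j ≤ C * N p := hNC j p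
        _ ≤ C * (2 * 2 ^ k) := by gcongr
        _ = _ := by ring
    have hlow : 2 ^ k ≤ C * N j := hk1.trans (hNC p j)
    have hkpos : (0 : ℝ) < 2 ^ k := by positivity
    -- Size and decay together give `2 ^ k * 4 ^ (-a j)` up to constants: one factor `2 ^ (-a j)`
    -- enters the box density, the other pays for the weight.
    have hmul : ‖κ j (y j)‖ * (2 ^ a j * 2 ^ a j) ≤ 8 * c * C * 2 ^ k := by
      rcases le_max_iff.1 (ha2 j) with h | h
      · have : (2 : ℝ) ^ a j * 2 ^ a j ≤ 1 := mul_le_one₀ h (by positivity) h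
        calc _ ≤ ‖κ j (y j)‖ * 1 := by gcongr
          _ ≤ c * N j := by rw [mul_one]; exact h1 _ _
          _ ≤ c * (2 * C * 2 ^ k) := by gcongr
          _ ≤ 8 * c * C * 2 ^ k := by
            have : 0 ≤ c * C * 2 ^ k := by positivity
            linarith
      · calc _ ≤ ‖κ j (y j)‖ * ((2 * (2 ^ k * ‖y j‖)) * (2 * (2 ^ k * ‖y j‖))) := by gcongr
          _ = 4 * 2 ^ k * (‖κ j (y j)‖ * (2 ^ k * ‖y j‖ ^ 2)) := by ring
          _ ≤ 4 * 2 ^ k * (‖κ j (y j)‖ * (C * N j * ‖y j‖ ^ 2)) := by gcongr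
          _ = 4 * 2 ^ k * C * (‖κ j (y j)‖ * (N j * ‖y j‖ ^ 2)) := by ring
          _ ≤ 4 * 2 ^ k * C * c := by gcongr; exact h2 _ _
          _ ≤ 8 * c * C * 2 ^ k := by
            have : 0 ≤ c * C * 2 ^ k := by positivity
            linarith
    have hpos : (0 : ℝ) < 2 ^ a j * 2 ^ a j := by positivity
    rw [← le_div_iff₀ hpos] at hmul
    refine hmul.trans (le_of_eq ?_)
    rw [div_pow, one_pow]
    field_simp
  calc ‖∏ j, κ j (y j)‖ = ∏ j, ‖κ j (y j)‖ := norm_prod _ _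
    _ ≤ ∏ j, (8 * c * C * (1 / 2) ^ a j * (2 ^ k / 2 ^ a j)) :=
        Finset.prod_le_prod (fun _ _ => norm_nonneg _) fun j _ => hκ j
    _ = (8 * c * C) ^ m * (1 / 2) ^ (∑ j, a j) * boxDensity a k := by
        rw [Finset.prod_mul_distrib, Finset.prod_mul_distrib, Finset.prod_const,
          Finset.prod_pow_eq_pow_sum, boxDensity, Finset.card_univ, Fintype.card_fin]
    _ ≤ _ := by
        have := (boxDensity_pos a k).le
        have := half_le_decayRate_sq hm
        gcongr

/-- The scales are `n j + 1`; replacing `C` by `max C 1` keeps them comparable after the shift by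
one. -/
lemma isBoxDominated_fejer {m : ℕ} (hm : 1 ≤ m) (C : ℝ) {n : Fin m → ℕ}
    (hn : ∀ j l, (n j : ℝ) ≤ C * n l) :
    IsBoxDominated ((8 * 2 * max C 1) ^ m) (fejerKernelMulti n) := by
  refine isBoxDominated_prod hm (by norm_num) (le_max_right _ _) (N := fun j => (n j : ℝ) + 1)
    (fun j => by simp) (fun j l => ?_) (fun j t => norm_fejerKernel_le _ _)
    (fun j t => norm_fejerKernel_mul_le _ _)
  have h1 := hn j l
  have h2 := le_max_left C 1
  have h3 := le_max_right C 1
  have h4 : (0 : ℝ) ≤ n l := by positivity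
  nlinarith

lemma isBoxDominated_poisson {m : ℕ} (hm : 1 ≤ m) (C : ℝ) {r : Fin m → ℝ}
    (h0 : ∀ j, 0 ≤ r j ∧ r j < 1) (hr : ∀ j l, 1 - r j ≤ C * (1 - r l)) :
    IsBoxDominated ((8 * 2 * max C 1) ^ m) (poissonKernelMulti r) := by
  refine isBoxDominated_prod hm (by norm_num) (le_max_right _ _) (N := fun j => (1 - r j)⁻¹)
    (fun j => ?_) (fun j l => ?_) (fun j t => norm_poissonKernel_le (h0 j).1 (h0 j).2 _)
    (fun j t => norm_poissonKernel_mul_le (h0 j).1 (h0 j).2 _)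
  · exact (one_le_inv₀ (by linarith [(h0 j).2])).2 (by linarith [(h0 j).1])
  · have hj : 0 < 1 - r j := by linarith [(h0 j).2]
    have hl : 0 < 1 - r l := by linarith [(h0 l).2]
    rw [← div_eq_mul_inv, le_div_iff₀ hl, inv_mul_le_iff₀ hj, mul_comm]
    refine (hr l j).trans ?_
    gcongr
    exact le_max_left _ _

/-! ### Exponential sums and the Marcinkiewicz kernel -/

/-- Summation by parts. -/
lemma sum_pow_mul_sub_one (w : ℂ) (b : ℕ → ℂ) (n : ℕ) :
    (∑ l ∈ Finset.range (n + 1), w ^ l * b l) * (w - 1) =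
      w ^ (n + 1) * b n - b 0 - ∑ l ∈ Finset.range n, w ^ (l + 1) * (b (l + 1) - b l) := by
  induction n with
  | zero => simp; ring
  | succ n ih =>
    rw [Finset.sum_range_succ, add_mul, ih, Finset.sum_range_succ]
    ring

section products
variable {ι : Type*} (P : Finset ι) (x : ι → UnitAddCircle)

lemma norm_prod_dirichletKernel_le {n l : ℕ} (hl : l ≤ n) :
    ‖∏ j ∈ P, dirichletKernel l (x j)‖ ≤ (2 * (n + 1) : ℝ) ^ P.card := by
  rw [norm_prod, ← Finset.prod_const]
  refine Finset.prod_le_prod (fun _ _ => norm_nonneg _) fun j _ => (norm_dirichletKernel_le l _).trans ?_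
  have : (l : ℝ) ≤ n := by exact_mod_cast hl
  linarith

/-- By the product rule, each difference replaces one factor of size `2 * (n + 1)` by one of size 2.
-/
lemma norm_prod_dirichletKernel_succ_sub_le {n l : ℕ} (hl : l + 1 ≤ n) :
    (n + 1 : ℝ) * ‖∏ j ∈ P, dirichletKernel (l + 1) (x j) - ∏ j ∈ P, dirichletKernel l (x j)‖ ≤
      P.card * (2 * (n + 1) : ℝ) ^ P.card := by
  classical
  induction P using Finset.induction_on with
  | empty => simp
  | insert i P hi ih =>
    rw [Finset.prod_insert hi, Finset.prod_insert hi, Finset.card_insert_of_notMem hi]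
    set A := ∏ j ∈ P, dirichletKernel (l + 1) (x j)
    set B := ∏ j ∈ P, dirichletKernel l (x j)
    have hA : ‖A‖ ≤ (2 * (n + 1) : ℝ) ^ P.card := norm_prod_dirichletKernel_le P x hl
    have h1 := norm_dirichletKernel_succ_sub_le l (x i)
    have h2 : ‖dirichletKernel l (x i)‖ ≤ 2 * (n + 1) := by
      refine (norm_dirichletKernel_le l _).trans ?_
      have : (l : ℝ) + 1 ≤ n := by exact_mod_cast hl
      linarith
    have hsplit : dirichletKernel (l + 1) (x i) * A - dirichletKernel l (x i) * B =
        (dirichletKernel (l + 1) (x i) - dirichletKernel l (x i)) * A +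
          dirichletKernel l (x i) * (A - B) := by ring
    have hn : (0 : ℝ) ≤ n + 1 := by positivity
    calc (n + 1 : ℝ) * ‖dirichletKernel (l + 1) (x i) * A - dirichletKernel l (x i) * B‖
        ≤ (n + 1) * (‖dirichletKernel (l + 1) (x i) - dirichletKernel l (x i)‖ * ‖A‖ +
          ‖dirichletKernel l (x i)‖ * ‖A - B‖) := by
          rw [hsplit]
          gcongr
          refine (norm_add_le _ _).trans ?_
          rw [norm_mul, norm_mul]
      _ ≤ (n + 1) * (2 * (2 * (n + 1) : ℝ) ^ P.card + 2 * (n + 1) * ‖A - B‖) := by gcongr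
      _ = 2 * (n + 1) * (2 * (n + 1) : ℝ) ^ P.card + 2 * (n + 1) * ((n + 1) * ‖A - B‖) := by ring
      _ ≤ 2 * (n + 1) * (2 * (n + 1) : ℝ) ^ P.card +
          2 * (n + 1) * (P.card * (2 * (n + 1) : ℝ) ^ P.card) := by gcongr
      _ = _ := by push_cast; ring

lemma norm_sum_pow_mul_prod_le {w : ℂ} (hw : ‖w‖ = 1) (n : ℕ) :
    ‖∑ l ∈ Finset.range (n + 1), w ^ l * ∏ j ∈ P, dirichletKernel l (x j)‖ ≤
      (n + 1) * (2 * (n + 1) : ℝ) ^ P.card := by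
  refine (norm_sum_le _ _).trans ?_
  calc _ ≤ ∑ _l ∈ Finset.range (n + 1), (2 * (n + 1) : ℝ) ^ P.card := by
        refine Finset.sum_le_sum fun l hl => ?_
        rw [norm_mul, norm_pow, hw, one_pow, one_mul]
        exact norm_prod_dirichletKernel_le P x (Nat.lt_succ_iff.1 (Finset.mem_range.1 hl))
    _ = _ := by rw [Finset.sum_const, Finset.card_range, nsmul_eq_mul]; push_cast; ring

/-- After summation by parts, the boundary terms cost `2 * Q` with `Q = (2 * (n + 1)) ^ P.card`, and
the total variation of the products costs at most `P.card * Q`. -/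
lemma norm_sum_pow_mul_prod_mul_le {w : ℂ} (hw : ‖w‖ = 1) (n : ℕ) :
    ‖∑ l ∈ Finset.range (n + 1), w ^ l * ∏ j ∈ P, dirichletKernel l (x j)‖ * ‖w - 1‖ ≤
      (P.card + 2) * (2 * (n + 1) : ℝ) ^ P.card := by
  rw [← norm_mul, sum_pow_mul_sub_one]
  set b : ℕ → ℂ := fun l => ∏ j ∈ P, dirichletKernel l (x j)
  set Q := (2 * (n + 1) : ℝ) ^ P.card
  have hb : ∀ l ≤ n, ‖b l‖ ≤ Q := fun l hl => norm_prod_dirichletKernel_le P x hl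
  have hn : (0 : ℝ) < n + 1 := by positivity
  have hvar : ‖∑ l ∈ Finset.range n, w ^ (l + 1) * (b (l + 1) - b l)‖ ≤ P.card * Q := by
    have h1 : ‖∑ l ∈ Finset.range n, w ^ (l + 1) * (b (l + 1) - b l)‖ ≤
        ∑ _l ∈ Finset.range n, P.card * Q / (n + 1) := by
      refine (norm_sum_le _ _).trans (Finset.sum_le_sum fun l hl => ?_)
      rw [norm_mul, norm_pow, hw, one_pow, one_mul, le_div_iff₀' hn]
      exact norm_prod_dirichletKernel_succ_sub_le P x (Finset.mem_range.1 hl)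
    refine h1.trans ?_
    rw [Finset.sum_const, Finset.card_range, nsmul_eq_mul, mul_div_assoc', div_le_iff₀ hn]
    have : 0 ≤ P.card * Q := by positivity
    nlinarith
  have h1 := norm_sub_le (w ^ (n + 1) * b n - b 0)
    (∑ l ∈ Finset.range n, w ^ (l + 1) * (b (l + 1) - b l))
  have h2 := norm_sub_le (w ^ (n + 1) * b n) (b 0)
  rw [norm_mul, norm_pow, hw, one_pow, one_mul] at h2
  have h3 := hb n le_rfl
  have h4 := hb 0 (Nat.zero_le _)
  change ‖w ^ (n + 1) * b n - b 0 - ∑ l ∈ Finset.range n, w ^ (l + 1) * (b (l + 1) - b l)‖ ≤ _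
  linarith

end products

/-- The signed sum of coordinates with sign `+` on `R` and `-` on `S \ R`. -/
def signedSum {m : ℕ} (S R : Finset (Fin m)) (x : Fin m → UnitAddCircle) : UnitAddCircle :=
  ∑ j ∈ R, x j - ∑ j ∈ S \ R, x j

lemma fourier_one_sum {ι : Type*} (P : Finset ι) (x : ι → UnitAddCircle) :
    (fourier 1 (∑ j ∈ P, x j) : ℂ) = ∏ j ∈ P, (fourier 1 (x j) : ℂ) := by
  classical
  induction P using Finset.induction_on with
  | empty => simp
  | insert i P hi ih =>
    rw [Finset.sum_insert hi, Finset.prod_insert hi, ← ih]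
    simp [fourier_apply, AddCircle.toCircle_add]

lemma fourier_one_signedSum {m : ℕ} (S R : Finset (Fin m)) (x : Fin m → UnitAddCircle) :
    (fourier 1 (signedSum S R x) : ℂ) =
      (∏ j ∈ R, (fourier 1 (x j) : ℂ)) * ∏ j ∈ S \ R, (fourier 1 (x j) : ℂ)⁻¹ := by
  have h : (fourier 1 (signedSum S R x) : ℂ) * fourier 1 (∑ j ∈ S \ R, x j) =
      fourier 1 (∑ j ∈ R, x j) := by
    have : ∑ j ∈ R, x j = signedSum S R x + ∑ j ∈ S \ R, x j := by
      rw [signedSum, sub_add_cancel]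
    rw [this]
    simp [fourier_apply, AddCircle.toCircle_add]
  rw [fourier_one_sum, fourier_one_sum] at h
  rw [Finset.prod_inv_distrib, ← h, mul_inv_cancel_right₀]
  exact Finset.prod_ne_zero_iff.2 fun j _ => fourier_ne_zero 1 _

/-- The exponential sum attached to a choice of signs. -/
def signedExpSum {m : ℕ} (S R : Finset (Fin m)) (n : ℕ) (x : Fin m → UnitAddCircle) : ℂ :=
  ∑ l ∈ Finset.range (n + 1),
    (fourier 1 (signedSum S R x) : ℂ) ^ l * ∏ j ∈ Sᶜ, dirichletKernel l (x j)

/-- Each factor over `S` becomes `z_j ^ (l + 1) - z_j ^ (-l)`. In the expanded product `R` records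
where the first term is taken, and the `l`-th powers combine into the character at `signedSum S R
x`. -/
lemma sum_prod_dirichletKernel_mul {m : ℕ} (S : Finset (Fin m)) (n : ℕ)
    (x : Fin m → UnitAddCircle) :
    (∑ l ∈ Finset.range (n + 1), ∏ j, dirichletKernel l (x j)) *
        ∏ j ∈ S, ((fourier 1 (x j) : ℂ) - 1) =
      ∑ R ∈ S.powerset, ((∏ j ∈ R, (fourier 1 (x j) : ℂ)) * ∏ _j ∈ S \ R, (-1 : ℂ)) *
        signedExpSum S R n x := by
  unfold signedExpSum
  simp_rw [Finset.mul_sum]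
  rw [Finset.sum_comm, Finset.sum_mul]
  refine Finset.sum_congr rfl fun l _ => ?_
  rw [← Finset.prod_mul_prod_compl S, mul_right_comm, ← Finset.prod_mul_distrib]
  simp_rw [dirichletKernel_mul, sub_eq_add_neg]
  rw [Finset.prod_add, Finset.sum_mul]
  refine Finset.sum_congr rfl fun R _ => ?_
  rw [fourier_one_signedSum, mul_pow, ← Finset.prod_pow, ← Finset.prod_pow]
  have h1 : ∏ j ∈ R, (fourier 1 (x j) : ℂ) ^ (l + 1) =
      (∏ j ∈ R, (fourier 1 (x j) : ℂ)) * ∏ j ∈ R, (fourier 1 (x j) : ℂ) ^ l := by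
    rw [← Finset.prod_mul_distrib]
    exact Finset.prod_congr rfl fun j _ => pow_succ' _ _
  have h2 : ∏ j ∈ S \ R, -((fourier 1 (x j) : ℂ)⁻¹) ^ l =
      (∏ _j ∈ S \ R, (-1 : ℂ)) * ∏ j ∈ S \ R, ((fourier 1 (x j) : ℂ)⁻¹) ^ l := by
    rw [← Finset.prod_mul_distrib]
    exact Finset.prod_congr rfl fun j _ => by ring
  rw [h1, h2]
  ring

/-- Only the largest of the at most `2 ^ m` exponential sums is kept; which one it is depends on the
point. -/
lemma marcinkiewiczKernel_mul_le {m : ℕ} (S : Finset (Fin m)) (n : ℕ)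
    (x : Fin m → UnitAddCircle) :
    ∃ R ∈ S.powerset, (n + 1) * ‖marcinkiewiczKernel n x‖ * ∏ j ∈ S, (4 * ‖x j‖) ≤
      2 ^ m * ‖signedExpSum S R n x‖ := by
  obtain ⟨R, hR, hmax⟩ := Finset.exists_max_image S.powerset
    (fun R => ‖signedExpSum S R n x‖) ⟨∅, Finset.empty_mem_powerset S⟩
  refine ⟨R, hR, ?_⟩
  have hn : (0 : ℝ) < n + 1 := by positivity
  have hn' : ‖((n : ℂ) + 1)⁻¹‖ = ((n : ℝ) + 1)⁻¹ := by
    rw [norm_inv]; congr 1; exact_mod_cast Complex.norm_natCast (n + 1)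
  rw [marcinkiewiczKernel, norm_mul, hn', mul_inv_cancel_left₀ hn.ne']
  calc ‖∑ l ∈ Finset.range (n + 1), ∏ j, dirichletKernel l (x j)‖ * ∏ j ∈ S, (4 * ‖x j‖)
      ≤ ‖∑ l ∈ Finset.range (n + 1), ∏ j, dirichletKernel l (x j)‖ *
          ∏ j ∈ S, ‖(fourier 1 (x j) : ℂ) - 1‖ := by
        gcongr with j
        exact four_mul_norm_le _
    _ = ‖∑ R ∈ S.powerset, ((∏ j ∈ R, (fourier 1 (x j) : ℂ)) * ∏ _j ∈ S \ R, (-1 : ℂ)) *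
        signedExpSum S R n x‖ := by
        rw [← norm_prod, ← norm_mul, sum_prod_dirichletKernel_mul]
    _ ≤ ∑ _R ∈ S.powerset, ‖signedExpSum S R n x‖ := by
        refine (norm_sum_le _ _).trans (Finset.sum_le_sum fun R' hR' => ?_)
        rw [norm_mul, norm_mul, norm_prod, norm_prod]
        simp only [norm_fourier_apply, norm_neg, norm_one, Finset.prod_const_one, one_mul]
        exact hmax R' hR'
    _ = 2 ^ S.card * ‖signedExpSum S R n x‖ := by
        rw [Finset.sum_const, Finset.card_powerset, nsmul_eq_mul]; push_cast; rfl
    _ ≤ _ := by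
        gcongr
        · norm_num
        · simpa using Finset.card_le_univ S

/-- A signed sum is, up to sign, the pivot coordinate of a shear. -/
lemma exists_shear_eq_signedSum {m : ℕ} {S R : Finset (Fin m)} (hR : R ⊆ S) {p : Fin m}
    (hp : p ∈ S) : ∃ ε : Fin m → SignType, ∀ x, ‖shear p ε x p‖ = ‖signedSum S R x‖ := by
  set δ : Fin m → SignType := fun j => if j ∈ R then 1 else if j ∈ S then -1 else 0 with hδ
  have hsum : ∀ x, signedSum S R x = ∑ j, ((δ j : ℤ)) • x j := by
    intro x
    have h1 : ∑ j, ((δ j : ℤ)) • x j = ∑ j ∈ S, ((δ j : ℤ)) • x j := by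
      refine (Finset.sum_subset (Finset.subset_univ S) fun j _ hj => ?_).symm
      have : j ∉ R := fun h => hj (hR h)
      simp [hδ, hj, this]
    rw [h1, ← Finset.sum_sdiff hR, signedSum, sub_eq_neg_add, ← Finset.sum_neg_distrib]
    congr 1
    · refine Finset.sum_congr rfl fun j hj => ?_
      rw [Finset.mem_sdiff] at hj
      simp [hδ, hj.1, hj.2]
    · refine Finset.sum_congr rfl fun j hj => ?_
      simp [hδ, hj]
  -- Multiplying by the sign `δ p` gives the pivot coefficient `+1`, at the price of a global sign
  -- that the norm ignores.
  refine ⟨fun j => δ p * δ j, fun x => ?_⟩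
  have hshear : shear p (fun j => δ p * δ j) x p = (δ p : ℤ) • signedSum S R x := by
    have hsq : (δ p : ℤ) * (δ p : ℤ) = 1 := by
      by_cases h : p ∈ R <;> simp [hδ, h, hp]
    rw [shear_apply_self, hsum, Finset.smul_sum,
      ← Finset.add_sum_erase _ _ (Finset.mem_univ p), smul_smul, hsq, one_smul]
    congr 1
    refine Finset.sum_congr rfl fun j _ => ?_
    rw [smul_smul, SignType.coe_mul]
  rw [hshear]
  by_cases h : p ∈ R <;> simp [hδ, h, hp]

/-- The trivial bound serves when `2 ^ a ≤ 1`, and the bound from summation by parts otherwise. -/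
lemma norm_signedExpSum_mul_le {m : ℕ} (S R : Finset (Fin m)) (n : ℕ) (x : Fin m → UnitAddCircle)
    {k a : ℕ} (hk : (n + 1 : ℝ) ≤ 2 * 2 ^ k)
    (ha : (2 : ℝ) ^ a ≤ max 1 (2 * (2 ^ k * ‖signedSum S R x‖))) :
    ‖signedExpSum S R n x‖ * 2 ^ a ≤ 2 * (m + 2) * (2 * (n + 1) : ℝ) ^ Sᶜ.card * 2 ^ k := by
  have hw := norm_fourier_apply 1 (signedSum S R x)
  have h1 := norm_sum_pow_mul_prod_le Sᶜ x hw n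
  have h2 := norm_sum_pow_mul_prod_mul_le Sᶜ x hw n
  change ‖signedExpSum S R n x‖ ≤ _ at h1
  change ‖signedExpSum S R n x‖ * _ ≤ _ at h2
  set G := ‖signedExpSum S R n x‖ with hG
  set Q := (2 * (n + 1) : ℝ) ^ Sᶜ.card with hQ
  have hQ0 : 0 ≤ Q := by positivity
  have hG0 : 0 ≤ G := norm_nonneg _
  have hcard : (Sᶜ.card : ℝ) ≤ m := by
    exact_mod_cast (by simpa using Finset.card_le_univ Sᶜ : Sᶜ.card ≤ m)
  rcases le_max_iff.1 ha with h | h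
  · calc G * 2 ^ a ≤ G * 1 := by gcongr
      _ ≤ (n + 1) * Q := by rw [mul_one]; exact h1
      _ ≤ 2 * 2 ^ k * Q := by gcongr
      _ ≤ 2 * (m + 2) * Q * 2 ^ k := by
        have h3 : 0 ≤ Q * 2 ^ k := by positivity
        have h4 : (0 : ℝ) ≤ m := by positivity
        nlinarith
  · calc G * 2 ^ a ≤ G * (2 * (2 ^ k * ‖signedSum S R x‖)) := by gcongr
      _ = 2 * 2 ^ k * (G * ‖signedSum S R x‖) := by ring
      _ ≤ 2 * 2 ^ k * (G * ‖(fourier 1 (signedSum S R x) : ℂ) - 1‖) := by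
        gcongr
        linarith [four_mul_norm_le (signedSum S R x), norm_nonneg (signedSum S R x)]
      _ ≤ 2 * 2 ^ k * ((Sᶜ.card + 2) * Q) := by gcongr
      _ ≤ 2 * 2 ^ k * ((m + 2) * Q) := by gcongr
      _ = _ := by ring

lemma norm_signedSum_le {m : ℕ} {S R : Finset (Fin m)} (hR : R ⊆ S) {x : Fin m → UnitAddCircle}
    {p : Fin m} (hp : ∀ j, ‖x j‖ ≤ ‖x p‖) : ‖signedSum S R x‖ ≤ m * ‖x p‖ := by
  calc ‖signedSum S R x‖ ≤ ‖∑ j ∈ R, x j‖ + ‖∑ j ∈ S \ R, x j‖ := norm_sub_le _ _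
    _ ≤ ∑ j ∈ R, ‖x j‖ + ∑ j ∈ S \ R, ‖x j‖ := add_le_add (norm_sum_le _ _) (norm_sum_le _ _)
    _ = ∑ j ∈ S, ‖x j‖ := by rw [add_comm, Finset.sum_sdiff hR]
    _ ≤ ∑ j, ‖x j‖ := Finset.sum_le_sum_of_subset_of_nonneg (Finset.subset_univ _)
        fun _ _ _ => norm_nonneg _
    _ ≤ ∑ _j : Fin m, ‖x p‖ := Finset.sum_le_sum fun j _ => hp j
    _ = _ := by simp

lemma norm_marcinkiewiczKernel_le {m : ℕ} (n : ℕ) (x : Fin m → UnitAddCircle) :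
    ‖marcinkiewiczKernel n x‖ ≤ (2 * (n + 1) : ℝ) ^ m := by
  have hn : (0 : ℝ) < n + 1 := by positivity
  have hn' : ‖((n : ℂ) + 1)⁻¹‖ = ((n : ℝ) + 1)⁻¹ := by
    rw [norm_inv]; congr 1; exact_mod_cast Complex.norm_natCast (n + 1)
  rw [marcinkiewiczKernel, norm_mul, hn', inv_mul_le_iff₀ hn]
  simpa using norm_sum_pow_mul_prod_le Finset.univ x (norm_one (α := ℂ)) n

/-- The bound for the Marcinkiewicz kernel when some coordinate is at least `1 / (n + 1)`. -/
lemma marcinkiewiczKernel_bound_of_large {m : ℕ} (hm : 1 ≤ m) {n k : ℕ}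
    (hk1 : (2 : ℝ) ^ k ≤ n + 1) (hk2 : (n + 1 : ℝ) ≤ 2 * 2 ^ k) {x : Fin m → UnitAddCircle}
    {p : Fin m} (hmax : ∀ j, ‖x j‖ ≤ ‖x p‖) (hp : 1 ≤ (n + 1) * ‖x p‖) :
    ∃ i : ShearIndex m, x ∈ shearBox i.1.1 i.1.2 i.2 1 k ∧
      ‖marcinkiewiczKernel n x‖ ≤ 2 ^ m * (m + 2) * m * 8 ^ m *
        (decayRate m * decayRate m) ^ (∑ j, i.2 j) * boxDensity i.2 k := by
  classical
  set S : Finset (Fin m) := Finset.univ.filter fun j => 1 ≤ (n + 1) * ‖x j‖ with hS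
  have hpS : p ∈ S := by simp [hS, hp]
  obtain ⟨R, hR, hbound⟩ := marcinkiewiczKernel_mul_le S n x
  rw [Finset.mem_powerset] at hR
  obtain ⟨ε, hε⟩ := exists_shear_eq_signedSum hR hpS
  choose a ha1 ha2 using fun j => exists_two_pow_ge (2 ^ k * ‖shear p ε x j‖)
  refine ⟨((p, ε), a), fun j => by simpa using ha1 j, ?_⟩
  have hN : (0 : ℝ) < n + 1 := by positivity
  have hX : 0 < ‖x p‖ := pos_of_mul_pos_right (lt_of_lt_of_le one_pos hp) hN.le
  have hm1 : (1 : ℝ) ≤ m := by exact_mod_cast hm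
  set N : ℝ := n + 1 with hNdef
  set Q := (2 * N) ^ Sᶜ.card with hQ
  have hG := norm_signedExpSum_mul_le S R n x hk2 (hε x ▸ ha2 p)
  set G := ‖signedExpSum S R n x‖ with hGdef
  set W := (decayRate m * decayRate m) ^ (∑ j, a j) with hW
  have hW0 : 0 ≤ W := by have := decayRate_pos m; positivity
  -- The averaging factor `1/N` and the divisor `4‖x p‖` of the pivot are left over once the box
  -- density is formed. Since `x p` is the largest coordinate, every sheared coordinate is at most
  -- `m * ‖x p‖`, so this leftover gains `2 ^ (-a j)` for all `j`.
  have hweight : 1 / (N * (4 * ‖x p‖)) ≤ m / 2 * W := by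
    refine le_decayRate_pow hm (by positivity) a fun j => ?_
    have hy : ‖shear p ε x j‖ ≤ m * ‖x p‖ := by
      by_cases hj : j = p
      · rw [hj, hε]
        exact norm_signedSum_le hR hmax
      · rw [shear_apply_of_ne _ _ _ hj]
        refine (hmax j).trans ?_
        nlinarith
    have hE : (2 : ℝ) ^ a j ≤ 2 * m * (N * ‖x p‖) := by
      refine (ha2 j).trans (max_le ?_ ?_)
      · nlinarith
      · calc 2 * (2 ^ k * ‖shear p ε x j‖) ≤ 2 * (N * (m * ‖x p‖)) := by gcongr
          _ = _ := by ring
    rw [div_le_div_iff₀ (by positivity) (by positivity)]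
    linarith
  have hlarge : ∀ j ∈ S.erase p, 1 / (4 * ‖x j‖) ≤ 2 ^ k / 2 ^ a j := by
    intro j hj
    rw [Finset.mem_erase] at hj
    have hjS : 1 ≤ N * ‖x j‖ := by simpa [hS] using hj.2
    have hxj : 0 < ‖x j‖ := pos_of_mul_pos_right (lt_of_lt_of_le one_pos hjS) hN.le
    have hE := ha2 j
    rw [shear_apply_of_ne _ _ _ hj.1] at hE
    have h2 : N * ‖x j‖ ≤ 2 * 2 ^ k * ‖x j‖ := by gcongr
    have hE' : (2 : ℝ) ^ a j ≤ 4 * (2 ^ k * ‖x j‖) :=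
      hE.trans (max_le (by nlinarith) (by nlinarith [norm_nonneg (x j)]))
    rw [div_le_div_iff₀ (by positivity) (by positivity)]
    linarith
  have hsmall : ∀ j ∈ Sᶜ, 2 * N ≤ 8 * (2 ^ k / 2 ^ a j) := by
    intro j hj
    have hjS : N * ‖x j‖ < 1 := by simpa [hS] using hj
    have hjp : j ≠ p := fun h => by rw [h] at hj; exact (Finset.mem_compl.1 hj) hpS
    have hE := ha2 j
    rw [shear_apply_of_ne _ _ _ hjp] at hE
    have h2 : 2 ^ k * ‖x j‖ ≤ N * ‖x j‖ := by gcongr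
    have hE' : (2 : ℝ) ^ a j ≤ 2 := hE.trans (max_le (by norm_num) (by linarith))
    rw [mul_div_assoc', le_div_iff₀ (by positivity)]
    calc 2 * N * 2 ^ a j ≤ 2 * (2 * 2 ^ k) * 2 := by gcongr
      _ = _ := by ring
  have hQle : Q ≤ 8 ^ m * ∏ j ∈ Sᶜ, ((2 : ℝ) ^ k / 2 ^ a j) := by
    calc Q = ∏ _j ∈ Sᶜ, 2 * N := by rw [Finset.prod_const]
      _ ≤ ∏ j ∈ Sᶜ, 8 * ((2 : ℝ) ^ k / 2 ^ a j) :=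
        Finset.prod_le_prod (fun _ _ => by positivity) hsmall
      _ = 8 ^ Sᶜ.card * ∏ j ∈ Sᶜ, ((2 : ℝ) ^ k / 2 ^ a j) := by
        rw [Finset.prod_mul_distrib, Finset.prod_const]
      _ ≤ _ := by
        gcongr
        · norm_num
        · simpa using Finset.card_le_univ Sᶜ
  have hGle : G ≤ 2 * (m + 2) * Q * (2 ^ k / 2 ^ a p) := by
    rw [mul_div_assoc', le_div_iff₀ (by positivity)]
    exact hG
  have hprodpos : 0 < ∏ j ∈ S.erase p, (4 * ‖x j‖) := by
    refine Finset.prod_pos fun j hj => ?_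
    have hjS : 1 ≤ N * ‖x j‖ := by simpa [hS] using (Finset.mem_erase.1 hj).2
    have hxj : 0 < ‖x j‖ := pos_of_mul_pos_right (lt_of_lt_of_le one_pos hjS) hN.le
    positivity
  have hprodle : (∏ j ∈ S.erase p, (4 * ‖x j‖))⁻¹ ≤ ∏ j ∈ S.erase p, ((2 : ℝ) ^ k / 2 ^ a j) := by
    rw [← Finset.prod_inv_distrib]
    refine Finset.prod_le_prod (fun j _ => by positivity) fun j hj => ?_
    rw [← one_div]
    exact hlarge j hj
  -- The sides of the box come from three sources: the exponential sum at the pivot, the divisors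
  -- `4‖x j‖` on the rest of `S`, and the trivial Dirichlet bounds off `S`.
  have hdens : boxDensity a k = (2 ^ k / 2 ^ a p) * (∏ j ∈ S.erase p, ((2 : ℝ) ^ k / 2 ^ a j)) *
      ∏ j ∈ Sᶜ, ((2 : ℝ) ^ k / 2 ^ a j) := by
    rw [boxDensity, ← Finset.prod_mul_prod_compl S, Finset.mul_prod_erase S (fun j => (2 : ℝ) ^ k / 2 ^ a j) hpS]
  have hprodS : ∏ j ∈ S, (4 * ‖x j‖) = 4 * ‖x p‖ * ∏ j ∈ S.erase p, (4 * ‖x j‖) :=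
    (Finset.mul_prod_erase S (fun j => 4 * ‖x j‖) hpS).symm
  rw [hprodS] at hbound
  set V := ∏ j ∈ S.erase p, (4 * ‖x j‖) with hV
  have hstart : ‖marcinkiewiczKernel n x‖ ≤ 2 ^ m * G * (1 / (N * (4 * ‖x p‖))) * V⁻¹ := by
    have hrw : 2 ^ m * G * (1 / (N * (4 * ‖x p‖))) * V⁻¹ = 2 ^ m * G / (N * (4 * ‖x p‖ * V)) := by
      field_simp
    rw [hrw, le_div_iff₀ (by positivity)]
    calc _ = N * ‖marcinkiewiczKernel n x‖ * (4 * ‖x p‖ * V) := by ring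
      _ ≤ _ := hbound
  refine hstart.trans ?_
  rw [hdens]
  set E := ∏ j ∈ S.erase p, ((2 : ℝ) ^ k / 2 ^ a j) with hE
  set F := ∏ j ∈ Sᶜ, ((2 : ℝ) ^ k / 2 ^ a j) with hF
  have hE0 : 0 ≤ E := Finset.prod_nonneg fun _ _ => by positivity
  have hF0 : 0 ≤ F := Finset.prod_nonneg fun _ _ => by positivity
  have hV0 : 0 ≤ V⁻¹ := inv_nonneg.2 hprodpos.le
  have hG1 : 2 ^ m * G ≤ 2 ^ m * (2 * (m + 2) * (8 ^ m * F) * (2 ^ k / 2 ^ a p)) :=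
    mul_le_mul_of_nonneg_left (hGle.trans (mul_le_mul_of_nonneg_right
      (mul_le_mul_of_nonneg_left hQle (by positivity)) (by positivity))) (by positivity)
  refine (mul_le_mul (mul_le_mul hG1 hweight (by positivity) (by positivity)) hprodle hV0
    (by positivity)).trans (le_of_eq ?_)
  ring

lemma isBoxDominated_marcinkiewicz {m : ℕ} (hm : 1 ≤ m) (n : ℕ) :
    IsBoxDominated (2 ^ m * (m + 2) * m * 8 ^ m) (marcinkiewiczKernel (m := m) n) := by
  have hN : (1 : ℝ) ≤ n + 1 := by simp
  obtain ⟨k, hk1, hk2⟩ := exists_nat_pow_near hN one_lt_two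
  have hk2' : (n + 1 : ℝ) ≤ 2 * 2 ^ k := by rw [pow_succ] at hk2; linarith
  refine ⟨k, fun x => ?_⟩
  have : Nonempty (Fin m) := ⟨⟨0, hm⟩⟩
  obtain ⟨p, hmax⟩ := Finite.exists_max fun j => ‖x j‖
  rcases le_or_gt 1 ((n + 1 : ℝ) * ‖x p‖) with hp | hp
  · exact marcinkiewiczKernel_bound_of_large hm hk1 hk2' hmax hp
  -- When all coordinates are below `1/(n+1)`, the trivial bound and the unit cube at scale `2 ^
  -- (-k)` suffice.
  · refine ⟨((p, 0), fun _ => 0), fun j => ?_, ?_⟩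
    · rw [shear_zero]
      have h1 : 2 ^ k * ‖x j‖ ≤ (n + 1) * ‖x p‖ := by
        gcongr
        exact hmax j
      simpa using h1.trans hp.le
    · have hm1 : (1 : ℝ) ≤ m := by exact_mod_cast hm
      calc ‖marcinkiewiczKernel n x‖ ≤ (2 * (n + 1) : ℝ) ^ m := norm_marcinkiewiczKernel_le n x
        _ ≤ (8 * 2 ^ k) ^ m := by
          refine pow_le_pow_left₀ (by positivity) ?_ m
          linarith [pow_pos (two_pos (α := ℝ)) k]
        _ = 1 * 8 ^ m * (2 ^ k) ^ m := by rw [mul_pow]; ring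
        _ ≤ (2 ^ m * (m + 2) * m) * 8 ^ m * (2 ^ k) ^ m := by
          gcongr
          have h2 : (1 : ℝ) ≤ 2 ^ m := one_le_pow₀ (by norm_num)
          have h3 : (1 : ℝ) ≤ m + 2 := by linarith
          exact one_le_mul_of_one_le_of_one_le (one_le_mul_of_one_le_of_one_le h2 h3) hm1
        _ = _ := by simp [boxDensity]

/-! ### Means of characters -/

lemma integral_fourier (n : ℤ) :
    ∫ s : UnitAddCircle, (fourier n s : ℂ) = if n = 0 then 1 else 0 := by
  split_ifs with h
  · subst h; simp
  · exact integral_eq_zero_of_add_right_eq_neg (fourier_add_half_inv_index h one_pos)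

lemma integral_fourier_sub_mul (a k : ℤ) (x : UnitAddCircle) :
    ∫ s : UnitAddCircle, (fourier a (x - s) : ℂ) * fourier k s =
      if a = k then (fourier k x : ℂ) else 0 := by
  have h : ∀ s : UnitAddCircle, (fourier a (x - s) : ℂ) * fourier k s =
      fourier a x * fourier (k - a) s := by
    intro s
    have hs := fourier_ne_zero 1 s
    have hsub : (fourier a (x - s) : ℂ) * fourier a s = fourier a x := by
      rw [fourier_apply, fourier_apply, fourier_apply, ← Circle.coe_mul, ← AddCircle.toCircle_add,
        ← smul_add, sub_add_cancel]
    rw [← hsub, fourier_eq_zpow k, fourier_eq_zpow (k - a), fourier_eq_zpow a s, mul_assoc,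
      ← zpow_add₀ hs, add_sub_cancel]
  simp_rw [h]
  rw [integral_const_mul, integral_fourier]
  by_cases hak : a = k
  · simp [hak]
  · rw [if_neg (sub_ne_zero.2 (Ne.symm hak)), if_neg hak, mul_zero]

lemma continuous_dirichletKernel (l : ℕ) : Continuous (dirichletKernel l) :=
  continuous_finsetSum _ fun k _ => (fourier k).continuous

lemma continuous_fejerKernel (n : ℕ) : Continuous (fejerKernel n) :=
  continuous_const.mul (continuous_finsetSum _ fun l _ => continuous_dirichletKernel l)

lemma continuous_fejerKernelMulti {m : ℕ} (n : Fin m → ℕ) : Continuous (fejerKernelMulti n) :=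
  continuous_finsetProd _ fun j _ => (continuous_fejerKernel (n j)).comp (continuous_apply j)

lemma continuous_marcinkiewiczKernel {m : ℕ} (n : ℕ) :
    Continuous (marcinkiewiczKernel (m := m) n) :=
  continuous_const.mul (continuous_finsetSum _ fun l _ => continuous_finsetProd _ fun j _ =>
    (continuous_dirichletKernel l).comp (continuous_apply j))

lemma summable_pow_natAbs {r : ℝ} (h0 : 0 ≤ r) (h1 : r < 1) :
    Summable fun k : ℤ => r ^ k.natAbs := by
  rw [summable_int_iff_summable_nat_and_neg]
  simpa using summable_geometric_of_lt_one h0 h1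

lemma continuous_poissonKernel {r : ℝ} (h0 : 0 ≤ r) (h1 : r < 1) :
    Continuous (poissonKernel r) := by
  refine continuous_tsum (fun k => continuous_const.mul (fourier k).continuous)
    (summable_pow_natAbs h0 h1) fun k t => ?_
  rw [norm_mul, norm_fourier_apply, mul_one, norm_pow, Complex.norm_real, Real.norm_of_nonneg h0]

lemma continuous_poissonKernelMulti {m : ℕ} {r : Fin m → ℝ} (hr : ∀ j, 0 ≤ r j ∧ r j < 1) :
    Continuous (poissonKernelMulti r) :=
  continuous_finsetProd _ fun j _ =>
    (continuous_poissonKernel (hr j).1 (hr j).2).comp (continuous_apply j)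

lemma integrable_of_continuous {X : Type*} [TopologicalSpace X] [CompactSpace X]
    [MeasurableSpace X] [OpensMeasurableSpace X] {μ : Measure X} [IsFiniteMeasure μ] {g : X → ℂ}
    (hg : Continuous g) : Integrable g μ := by
  simpa using hg.continuousOn.integrableOn_compact' (μ := μ) isCompact_univ MeasurableSet.univ

lemma integral_dirichletKernel_mul (l : ℕ) (k : ℤ) (x : UnitAddCircle) :
    ∫ s : UnitAddCircle, dirichletKernel l (x - s) * fourier k s =
      if k.natAbs ≤ l then (fourier k x : ℂ) else 0 := by
  unfold dirichletKernel
  simp_rw [Finset.sum_mul]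
  rw [integral_finsetSum _ fun a _ => integrable_of_continuous (by fun_prop)]
  simp_rw [integral_fourier_sub_mul]
  rw [Finset.sum_ite_eq' (Finset.Icc (-(l : ℤ)) (l : ℤ)) k]
  refine if_congr ?_ rfl rfl
  rw [Finset.mem_Icc]
  omega

/-- The character of `𝕋^m` with frequency `ν`. -/
def torusChar {m : ℕ} (ν : Fin m → ℤ) (y : Fin m → UnitAddCircle) : ℂ :=
  ∏ j, (fourier (ν j) (y j) : ℂ)

lemma continuous_torusChar {m : ℕ} (ν : Fin m → ℤ) : Continuous (torusChar ν) :=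
  continuous_finsetProd _ fun j _ => (fourier (ν j)).continuous.comp (continuous_apply j)

lemma integral_prod_mul_torusChar {m : ℕ} (κ : Fin m → UnitAddCircle → ℂ) (ν : Fin m → ℤ)
    (y : Fin m → UnitAddCircle) :
    ∫ s, (∏ j, κ j ((y - s) j)) * torusChar ν s =
      ∏ j, ∫ s : UnitAddCircle, κ j (y j - s) * fourier (ν j) s := by
  rw [← integral_fintype_prod_volume_eq_prod]
  simp_rw [torusChar, ← Finset.prod_mul_distrib, Pi.sub_apply]

lemma tendsto_succ_inv_mul_sum {u : ℕ → ℂ} {c : ℂ} (hu : Tendsto u atTop (𝓝 c)) :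
    Tendsto (fun n : ℕ => ((n : ℂ) + 1)⁻¹ * ∑ l ∈ Finset.range (n + 1), u l) atTop (𝓝 c) := by
  refine (hu.cesaro_smul.comp (tendsto_add_atTop_nat 1)).congr fun n => ?_
  simp [Complex.real_smul]

lemma tendsto_integral_dirichletKernel_mul (k : ℤ) (x : UnitAddCircle) :
    Tendsto (fun l => ∫ s : UnitAddCircle, dirichletKernel l (x - s) * fourier k s) atTop
      (𝓝 (fourier k x : ℂ)) := by
  refine tendsto_const_nhds.congr' ?_
  filter_upwards [eventually_ge_atTop k.natAbs] with l hl
  rw [integral_dirichletKernel_mul, if_pos hl]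

lemma tendsto_integral_fejerKernel_mul (k : ℤ) (x : UnitAddCircle) :
    Tendsto (fun n => ∫ s : UnitAddCircle, fejerKernel n (x - s) * fourier k s) atTop
      (𝓝 (fourier k x : ℂ)) := by
  refine (tendsto_succ_inv_mul_sum (tendsto_integral_dirichletKernel_mul k x)).congr fun n => ?_
  unfold fejerKernel
  simp_rw [mul_assoc, Finset.sum_mul]
  rw [integral_const_mul, integral_finsetSum]
  intro l _
  refine integrable_of_continuous (Continuous.mul ?_ (fourier k).continuous)
  exact (continuous_dirichletKernel l).comp (continuous_const.sub continuous_id)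

/-- The cubic Dirichlet means of a character are eventually equal to it, and Cesàro averages inherit
the limit. -/
lemma tendsto_integral_marcinkiewiczKernel_mul {m : ℕ} (ν : Fin m → ℤ)
    (y : Fin m → UnitAddCircle) :
    Tendsto (fun n => ∫ s, marcinkiewiczKernel n (y - s) * torusChar ν s) atTop
      (𝓝 (torusChar ν y)) := by
  have hlim : Tendsto (fun l => ∏ j, ∫ s : UnitAddCircle,
      dirichletKernel l (y j - s) * fourier (ν j) s) atTop (𝓝 (torusChar ν y)) :=
    tendsto_finsetProd _ fun j _ => tendsto_integral_dirichletKernel_mul (ν j) (y j)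
  refine (tendsto_succ_inv_mul_sum hlim).congr fun n => ?_
  unfold marcinkiewiczKernel
  simp_rw [mul_assoc, Finset.sum_mul]
  rw [integral_const_mul, integral_finsetSum]
  · simp_rw [integral_prod_mul_torusChar]
  · intro l _
    refine integrable_of_continuous (Continuous.mul ?_ (continuous_torusChar ν))
    exact continuous_finsetProd _ fun j _ => (continuous_dirichletKernel l).comp
      ((continuous_apply j).comp (continuous_const.sub continuous_id))

lemma integral_poissonKernel_mul {r : ℝ} (h0 : 0 ≤ r) (h1 : r < 1) (k : ℤ) (x : UnitAddCircle) :
    ∫ s : UnitAddCircle, poissonKernel r (x - s) * fourier k s =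
      (r : ℂ) ^ k.natAbs * fourier k x := by
  unfold poissonKernel
  simp_rw [← tsum_mul_right, mul_assoc]
  have hnorm : ∀ (a : ℤ) (s : UnitAddCircle),
      ‖(r : ℂ) ^ a.natAbs * ((fourier a (x - s) : ℂ) * fourier k s)‖ = r ^ a.natAbs := by
    intro a s
    rw [norm_mul, norm_mul, norm_fourier_apply, norm_fourier_apply, norm_pow, Complex.norm_real,
      Real.norm_of_nonneg h0, mul_one, mul_one]
  rw [← integral_tsum_of_summable_integral_norm]
  · simp_rw [integral_const_mul, integral_fourier_sub_mul]
    rw [tsum_eq_single k]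
    · simp
    · intro a ha
      simp [ha]
  · intro a
    exact integrable_of_continuous (by fun_prop)
  · simp_rw [hnorm]
    simpa using summable_pow_natAbs h0 h1

section means
variable {D : ℕ} {M : Fin D → ℕ}

lemma tendsto_boundedGrowth_apply (C : ℝ) (i : Fin D) (j : Fin (M i)) :
    Tendsto (fun n => n i j) (boundedGrowth M C) atTop := by
  refine Tendsto.mono_left (tendsto_atTop.2 fun b => ?_) inf_le_left
  filter_upwards [eventually_ge_atTop (fun _ _ => b)] with n hn using hn i j

lemma tendsto_integral_fejerKernelMulti_mul (C : ℝ) (i : Fin D) (ν : Fin (M i) → ℤ)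
    (y : Fin (M i) → UnitAddCircle) :
    Tendsto (fun n : (i : Fin D) → Fin (M i) → ℕ =>
      ∫ s, fejerKernelMulti (n i) (y - s) * torusChar ν s) (boundedGrowth M C)
      (𝓝 (torusChar ν y)) := by
  unfold fejerKernelMulti
  simp_rw [integral_prod_mul_torusChar]
  exact tendsto_finsetProd _ fun j _ =>
    (tendsto_integral_fejerKernel_mul (ν j) (y j)).comp (tendsto_boundedGrowth_apply C i j)

lemma eventually_boundedGrowthAbel (C : ℝ) : ∀ᶠ r in boundedGrowthAbel M C,
    (∀ i, ∀ j : Fin (M i), 0 ≤ r i j ∧ r i j < 1) ∧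
      ∀ i, ∀ j k : Fin (M i), 1 - r i j ≤ C * (1 - r i k) :=
  mem_inf_of_right (mem_principal_self _)

lemma tendsto_integral_poissonKernelMulti_mul (C : ℝ) (i : Fin D) (ν : Fin (M i) → ℤ)
    (y : Fin (M i) → UnitAddCircle) :
    Tendsto (fun r : (i : Fin D) → Fin (M i) → ℝ =>
      ∫ s, poissonKernelMulti (r i) (y - s) * torusChar ν s) (boundedGrowthAbel M C)
      (𝓝 (torusChar ν y)) := by
  unfold poissonKernelMulti
  simp_rw [integral_prod_mul_torusChar]
  refine tendsto_finsetProd _ fun j _ => ?_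
  have hlim : Tendsto (fun r : (i : Fin D) → Fin (M i) → ℝ =>
      (r i j : ℂ) ^ (ν j).natAbs * fourier (ν j) (y j)) (boundedGrowthAbel M C)
      (𝓝 (fourier (ν j) (y j) : ℂ)) := by
    have hcont : Continuous fun r : (i : Fin D) → Fin (M i) → ℝ =>
        (r i j : ℂ) ^ (ν j).natAbs * (fourier (ν j) (y j) : ℂ) := by fun_prop
    have := hcont.tendsto (fun _ _ => 1)
    simp only [Complex.ofReal_one, one_pow, one_mul] at this
    exact this.mono_left inf_le_left
  refine hlim.congr' ?_
  filter_upwards [eventually_boundedGrowthAbel C] with r hr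
  rw [integral_poissonKernel_mul (hr.1 i j).1 (hr.1 i j).2]

end means

/-! ### Comparison of the dyadic and logarithmic integrals -/

section classes
variable {X : Type*} [MeasurableSpace X] {μ : Measure X}

lemma dyadicLLog_eq_lintegral (k : ℕ) {h : X → ℝ≥0∞} (hh : Measurable h) :
    dyadicLLog μ k h = ∫⁻ x, ∑' n : ℕ, ((n : ℝ≥0∞) + 1) ^ k *
      (2 ^ n * if 2 ^ n < h x then 1 else 0) ∂μ := by
  have hlev : ∀ n : ℕ, MeasurableSet {x | 2 ^ n < h x} := fun n =>
    measurableSet_lt measurable_const hh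
  have hm : ∀ n : ℕ, Measurable fun x => if 2 ^ n < h x then (1 : ℝ≥0∞) else 0 := fun n =>
    Measurable.ite (hlev n) measurable_const measurable_const
  rw [lintegral_tsum fun n => (((hm n).const_mul _).const_mul _).aemeasurable]
  refine tsum_congr fun n => ?_
  rw [lintegral_const_mul _ ((hm n).const_mul _), lintegral_const_mul _ (hm n)]
  congr 2
  rw [← lintegral_indicator_one (hlev n)]
  refine lintegral_congr fun x => ?_
  by_cases hx : 2 ^ n < h x <;> simp [hx]

lemma tsum_dyadic_le_log (k : ℕ) {u : ℝ} (hu : 0 ≤ u) :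
    ∑' n : ℕ, ((n : ℝ≥0∞) + 1) ^ k * (2 ^ n * if 2 ^ n < ENNReal.ofReal u then 1 else 0) ≤
      ENNReal.ofReal (2 * (2 / Real.log 2) ^ k * (u * Real.log (u + 1) ^ k)) := by
  have hiff : ∀ n : ℕ, (2 : ℝ≥0∞) ^ n < ENNReal.ofReal u ↔ (2 : ℝ) ^ n < u := by
    intro n
    rw [← ENNReal.ofReal_ofNat 2, ← ENNReal.ofReal_pow (by norm_num),
      ENNReal.ofReal_lt_ofReal_iff_of_nonneg (by positivity)]
  simp_rw [hiff]
  rcases le_or_gt u 1 with h1 | h1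
  · have : ∀ n : ℕ, ¬ (2 : ℝ) ^ n < u := fun n =>
      not_lt.2 (h1.trans (one_le_pow₀ (by norm_num)))
    simp [this]
  -- The levels are strict, so `u = 2 ^ a` must be assigned to `N = a - 1`.
  · have hex : ∃ N : ℕ, (2 : ℝ) ^ N < u ∧ u ≤ 2 ^ (N + 1) := by
      obtain ⟨a, ha1, ha2⟩ := exists_nat_pow_near h1.le one_lt_two
      rcases eq_or_lt_of_le ha1 with h | h
      · cases a with
        | zero => simp at h; linarith
        | succ a =>
          refine ⟨a, ?_, h.ge⟩
          rw [← h, pow_succ]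
          linarith [pow_pos (two_pos (α := ℝ)) a]
      · exact ⟨a, h, ha2.le⟩
    obtain ⟨N, hN1, hN2⟩ := hex
    have hlog2 : 0 < Real.log 2 := Real.log_pos one_lt_two
    -- From `2 ^ (N + 1) ≤ 2 * u ≤ (u + 1) ^ 2`, whose square is the source of the constant `2 / log
    -- 2`.
    have hlog : (N : ℝ) + 1 ≤ 2 / Real.log 2 * Real.log (u + 1) := by
      rw [div_mul_eq_mul_div, le_div_iff₀ hlog2]
      calc ((N : ℝ) + 1) * Real.log 2 = Real.log (2 ^ (N + 1)) := by
            rw [Real.log_pow]; push_cast; ring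
        _ ≤ Real.log ((u + 1) ^ 2) := by
            refine Real.log_le_log (by positivity) ?_
            rw [pow_succ]
            nlinarith [pow_pos (two_pos (α := ℝ)) N]
        _ = 2 * Real.log (u + 1) := by rw [Real.log_pow]; norm_num
    rw [tsum_eq_sum (s := Finset.range (N + 1))]
    · calc _ ≤ ∑ n ∈ Finset.range (N + 1), ((N : ℝ≥0∞) + 1) ^ k * 2 ^ n := by
            refine Finset.sum_le_sum fun n hn => ?_
            have hnN : n ≤ N := Nat.lt_succ_iff.1 (Finset.mem_range.1 hn)
            calc _ ≤ ((N : ℝ≥0∞) + 1) ^ k * (2 ^ n * 1) := by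
                  gcongr
                  split_ifs <;> simp
              _ = _ := by rw [mul_one]
        _ = ENNReal.ofReal (((N : ℝ) + 1) ^ k * ∑ n ∈ Finset.range (N + 1), (2 : ℝ) ^ n) := by
            rw [← Finset.mul_sum, ENNReal.ofReal_mul (by positivity),
              ENNReal.ofReal_pow (by positivity), ENNReal.ofReal_add (by positivity) one_pos.le,
              ENNReal.ofReal_natCast, ENNReal.ofReal_one,
              ENNReal.ofReal_sum_of_nonneg fun _ _ => by positivity]
            congr 1
            refine Finset.sum_congr rfl fun n _ => ?_
            rw [ENNReal.ofReal_pow (by norm_num), ENNReal.ofReal_ofNat]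
        _ ≤ _ := by
            refine ENNReal.ofReal_le_ofReal ?_
            have hgeom : ∑ n ∈ Finset.range (N + 1), (2 : ℝ) ^ n ≤ 2 * u := by
              rw [geom_sum_eq (by norm_num), pow_succ]
              linarith
            have hlog0 : 0 ≤ Real.log (u + 1) := Real.log_nonneg (by linarith)
            calc ((N : ℝ) + 1) ^ k * ∑ n ∈ Finset.range (N + 1), (2 : ℝ) ^ n
                ≤ (2 / Real.log 2 * Real.log (u + 1)) ^ k * (2 * u) := by gcongr
              _ = _ := by rw [mul_pow]; ring
    · intro n hn
      have hnN : N + 1 ≤ n := by simpa using hn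
      rw [if_neg]
      · simp
      · rw [not_lt]
        exact hN2.trans (pow_le_pow_right₀ (by norm_num) hnN)

lemma MemLLogL.dyadicLLog_lt_top {f : X → ℂ} {k : ℕ} (hf : MemLLogL f k μ) (hm : Measurable f) :
    dyadicLLog μ k (fun x => ‖f x‖ₑ) < ∞ := by
  rw [dyadicLLog_eq_lintegral k hm.enorm]
  refine lt_of_le_of_lt (lintegral_mono fun x => ?_)
    (hf.2.const_mul (2 * (2 / Real.log 2) ^ k)).lintegral_lt_top
  have := tsum_dyadic_le_log k (norm_nonneg (f x))
  rwa [ofReal_norm] at this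

lemma MemLLogL.congr {f g : X → ℂ} {k : ℕ} (hf : MemLLogL f k μ) (hfg : f =ᵐ[μ] g) :
    MemLLogL g k μ :=
  ⟨hf.1.congr hfg, hf.2.congr (hfg.mono fun x hx => by simp only [hx])⟩

/-- Square integrable functions lie in every class `L (ln⁺ L)^k`. -/
lemma dyadicLLog_lt_top_of_sq {k : ℕ} {h : X → ℝ≥0∞} (hh : Measurable h)
    (hsq : ∫⁻ x, h x ^ 2 ∂μ < ∞) : dyadicLLog μ k h < ∞ := by
  have hle : ∀ n : ℕ, 2 ^ n * μ {x | 2 ^ n < h x} ≤ 2⁻¹ ^ n * ∫⁻ x, h x ^ 2 ∂μ := by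
    intro n
    have h1 : (2 ^ n) ^ 2 * μ {x | 2 ^ n < h x} ≤ ∫⁻ x, h x ^ 2 ∂μ := by
      refine le_trans ?_ (mul_meas_ge_le_lintegral (hh.pow_const 2) ((2 ^ n) ^ 2))
      gcongr with x
      intro hx
      exact pow_le_pow_left₀ zero_le (le_of_lt hx) 2
    have h2 : (2⁻¹ : ℝ≥0∞) ^ n * (2 ^ n) ^ 2 = 2 ^ n := by
      rw [sq, ← mul_assoc, ← mul_pow, ENNReal.inv_mul_cancel (by simp) (by simp), one_pow, one_mul]
    calc 2 ^ n * μ {x | 2 ^ n < h x} = 2⁻¹ ^ n * ((2 ^ n) ^ 2 * μ {x | 2 ^ n < h x}) := by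
          rw [← mul_assoc, h2]
      _ ≤ _ := by gcongr
  have hsum : ∑' n : ℕ, ((n : ℝ≥0∞) + 1) ^ k * 2⁻¹ ^ n ≠ ∞ := by
    have hs : Summable fun n : ℕ => ((n : ℝ) + 1) ^ k * (1 / 2) ^ n := by
      have h0 := (summable_nat_add_iff 1).2 (summable_pow_mul_geometric_of_norm_lt_one (R := ℝ) k
        (r := 1 / 2) (by norm_num))
      refine (h0.mul_left 2).congr fun n => ?_
      push_cast
      rw [pow_succ (1 / 2 : ℝ)]
      ring
    have := hs.tsum_ofReal_ne_top
    refine ne_of_eq_of_ne (tsum_congr fun n => ?_) this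
    rw [ENNReal.ofReal_mul (by positivity), ENNReal.ofReal_pow (by positivity),
      ENNReal.ofReal_pow (by positivity), ENNReal.ofReal_add (by positivity) one_pos.le,
      ENNReal.ofReal_natCast, ENNReal.ofReal_one, one_div, ENNReal.ofReal_inv_of_pos two_pos,
      ENNReal.ofReal_ofNat]
  refine lt_of_le_of_lt (b := (∑' n : ℕ, ((n : ℝ≥0∞) + 1) ^ k * 2⁻¹ ^ n) *
    ∫⁻ x, h x ^ 2 ∂μ) ?_ (ENNReal.mul_lt_top hsum.lt_top hsq)
  rw [← ENNReal.tsum_mul_right]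
  refine ENNReal.tsum_le_tsum fun n => ?_
  rw [mul_assoc]
  exact mul_le_mul_right (hle n) _

end classes

/-! ### Approximation by trigonometric polynomials -/

section approximation
variable {D : ℕ} {M : Fin D → ℕ}

/-- The characters of the torus `𝕋^N`. -/
def blockChar (ν : (i : Fin D) → Fin (M i) → ℤ) : C(BlockTorus M, ℂ) where
  toFun x := ∏ i, torusChar (ν i) (x i)
  continuous_toFun := continuous_finsetProd _ fun i _ =>
    (continuous_torusChar (ν i)).comp (continuous_apply i)

/-- The trigonometric polynomials on the torus `𝕋^N`. -/
def trigPolynomials (M : Fin D → ℕ) : Submodule ℂ C(BlockTorus M, ℂ) :=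
  Submodule.span ℂ (Set.range blockChar)

lemma exists_trigPolynomial_near (g : C(BlockTorus M, ℂ)) {ε : ℝ} (hε : 0 < ε) :
    ∃ h ∈ trigPolynomials M, ∀ x, ‖g x - h x‖ ≤ ε := by
  let φ : C(UnitAddTorus ((i : Fin D) × Fin (M i)), BlockTorus M) :=
    ⟨fun z i j => z ⟨i, j⟩, by fun_prop⟩
  let ψ : C(BlockTorus M, UnitAddTorus ((i : Fin D) × Fin (M i))) :=
    ⟨fun x q => x q.1 q.2, by fun_prop⟩
  have hmem : g.comp φ ∈ (Submodule.span ℂ (Set.range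
      (UnitAddTorus.mFourier (d := (i : Fin D) × Fin (M i))))).topologicalClosure := by
    rw [UnitAddTorus.span_mFourier_closure_eq_top]; trivial
  obtain ⟨p, hp, hdist⟩ := Metric.mem_closure_iff.1 hmem ε hε
  refine ⟨p.comp ψ, ?_, fun x => ?_⟩
  · refine Submodule.span_induction (p := fun p _ => p.comp ψ ∈ trigPolynomials M)
      ?_ ?_ ?_ ?_ hp
    · rintro _ ⟨ν, rfl⟩
      refine Submodule.subset_span ⟨fun i j => ν ⟨i, j⟩, ?_⟩
      ext x
      simp [blockChar, torusChar, UnitAddTorus.mFourier, ψ, Fintype.prod_sigma]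
    · exact (trigPolynomials M).zero_mem
    · intro p q _ _ hp hq
      exact (trigPolynomials M).add_mem hp hq
    · intro c p _ hp
      exact (trigPolynomials M).smul_mem c hp
  · have h1 := (g.comp φ - p).norm_coe_le_norm (ψ x)
    rw [← dist_eq_norm] at h1
    exact h1.trans hdist.le

lemma exists_trigPolynomial_sq_near {h : BlockTorus M → ℂ} (hh : MemLp h 2 volume) {ε : ℝ≥0∞}
    (hε : ε ≠ 0) : ∃ g ∈ trigPolynomials M, ∫⁻ x, ‖h x - g x‖ₑ ^ 2 ≤ ε := by
  obtain ⟨δ, hδ, hδε⟩ : ∃ δ : ℝ, 0 < δ ∧ ENNReal.ofReal (2 * δ) ^ 2 ≤ ε := by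
    rcases eq_or_ne ε ∞ with rfl | ht
    · exact ⟨1, one_pos, le_top⟩
    · have hpos := ENNReal.toReal_pos hε ht
      -- One half of the square root is for continuous approximation in L², the other for uniform
      -- approximation by polynomials.
      refine ⟨Real.sqrt ε.toReal / 2, by positivity, ?_⟩
      rw [← ENNReal.ofReal_pow (by positivity), mul_div_cancel₀ _ two_ne_zero,
        Real.sq_sqrt hpos.le, ENNReal.ofReal_toReal ht]
  obtain ⟨g, hg, hgm⟩ := hh.exists_boundedContinuous_eLpNorm_sub_le (by simp)
    (ε := ENNReal.ofReal δ) (by simpa using hδ)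
  obtain ⟨p, hp, hgp⟩ := exists_trigPolynomial_near (M := M) ⟨g, g.continuous⟩ hδ
  refine ⟨p, hp, ?_⟩
  have hpc : AEStronglyMeasurable (fun x => p x) (volume : Measure (BlockTorus M)) :=
    p.continuous.aestronglyMeasurable
  have h2 : eLpNorm (fun x => g x - p x) 2 (volume : Measure (BlockTorus M)) ≤
      ENNReal.ofReal δ := by
    refine (eLpNorm_le_of_ae_bound (ae_of_all _ hgp)).trans ?_
    simp
  have h3 : eLpNorm (fun x => h x - p x) 2 (volume : Measure (BlockTorus M)) ≤
      ENNReal.ofReal (2 * δ) := by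
    have hsplit : (fun x => h x - p x) = (h - ⇑g) + fun x => g x - p x := by
      ext x; simp
    rw [hsplit, two_mul, ENNReal.ofReal_add hδ.le hδ.le]
    refine (eLpNorm_add_le (hh.1.sub hgm.1) (hgm.1.sub hpc) (by norm_num)).trans ?_
    exact add_le_add hg h2
  have h4 := eLpNorm_nnreal_pow_eq_lintegral (μ := (volume : Measure (BlockTorus M)))
    (f := fun x => h x - p x) (p := 2) (by norm_num)
  norm_num at h4
  rw [← h4]
  refine le_trans ?_ hδε
  gcongr

/-- Trigonometric polynomials `g_n → f` almost everywhere with `sup_n |f - g_n|` in the class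
`L (ln⁺ L)^k` of `f`. -/
lemma exists_trigPolynomials_tendsto {f : BlockTorus M → ℂ} (hf : Measurable f) {k : ℕ}
    (hfin : dyadicLLog volume k (fun x => ‖f x‖ₑ) < ∞) :
    ∃ g : ℕ → C(BlockTorus M, ℂ), (∀ n, g n ∈ trigPolynomials M) ∧
      dyadicLLog volume k (fun x => ⨆ n, ‖f x - g n x‖ₑ) < ∞ ∧
      ∀ᵐ x, Tendsto (fun n => g n x) atTop (𝓝 (f x)) := by
  -- The truncations of `f` are square integrable, and approximating them with summable squared
  -- errors puts `sup_n |h n - g n|` in L², hence in every logarithmic class.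
  set h : ℕ → BlockTorus M → ℂ := fun n => {x | ‖f x‖ ≤ n}.indicator f with hdef
  have hset : ∀ n : ℕ, MeasurableSet {x | ‖f x‖ ≤ n} := fun n =>
    measurableSet_le hf.norm measurable_const
  have hhm : ∀ n, Measurable (h n) := fun n => hf.indicator (hset n)
  have hmem : ∀ n, MemLp (h n) 2 (volume : Measure (BlockTorus M)) := by
    intro n
    refine MemLp.of_bound (hhm n).aestronglyMeasurable n (ae_of_all _ fun x => ?_)
    by_cases hx : ‖f x‖ ≤ n
    · simp [hdef, hx]
    · simp [hdef, hx]
  choose g hg hgle using fun n => exists_trigPolynomial_sq_near (hmem n)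
    (ε := 2⁻¹ ^ n) (pow_ne_zero _ (by simp))
  have hdm : ∀ n, Measurable fun x => ‖h n x - g n x‖ₑ := fun n =>
    ((hhm n).sub (g n).continuous.measurable).enorm
  have hsum : ∫⁻ x, ∑' n, ‖h n x - g n x‖ₑ ^ 2 ≠ ∞ := by
    rw [lintegral_tsum fun n => ((hdm n).pow_const 2).aemeasurable]
    refine ne_top_of_le_ne_top ?_ (ENNReal.tsum_le_tsum hgle)
    rw [ENNReal.tsum_geometric]
    simp
  refine ⟨g, hg, ?_, ?_⟩
  · have hSm : Measurable fun x => ⨆ n, ‖h n x - g n x‖ₑ := Measurable.iSup hdm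
    have hS : dyadicLLog volume k (fun x => ⨆ n, ‖h n x - g n x‖ₑ) < ∞ := by
      refine dyadicLLog_lt_top_of_sq hSm (lt_of_le_of_lt (lintegral_mono fun x => ?_) hsum.lt_top)
      have hle : ∀ y : ℝ≥0∞, (∀ n, ‖h n x - g n x‖ₑ ^ 2 ≤ y) →
          (⨆ n, ‖h n x - g n x‖ₑ) ^ 2 ≤ y := by
        intro y hy
        have h2 : ⨆ n, ‖h n x - g n x‖ₑ ≤ y ^ (2⁻¹ : ℝ) := by
          refine iSup_le fun n => ?_
          rw [ENNReal.le_rpow_inv_iff two_pos]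
          exact_mod_cast hy n
        rw [ENNReal.le_rpow_inv_iff two_pos] at h2
        exact_mod_cast h2
      exact hle _ fun n => ENNReal.le_tsum n
    refine lt_of_le_of_lt (dyadicLLog_mono k fun x => ?_) (dyadicLLog_add_lt_top hfin hS)
    refine iSup_le fun n => ?_
    calc ‖f x - g n x‖ₑ = ‖(f x - h n x) + (h n x - g n x)‖ₑ := by rw [sub_add_sub_cancel]
      _ ≤ ‖f x - h n x‖ₑ + ‖h n x - g n x‖ₑ := enorm_add_le _ _
      _ ≤ ‖f x‖ₑ + ⨆ n, ‖h n x - g n x‖ₑ := by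
        gcongr
        · by_cases hx : ‖f x‖ ≤ n <;> simp [hdef, hx]
        · exact le_iSup (fun n => ‖h n x - g n x‖ₑ) n
  · have hae := ae_lt_top (Measurable.tsum fun n => (hdm n).pow_const 2) hsum
    filter_upwards [hae] with x hx
    have h1 : Tendsto (fun n => ‖h n x - g n x‖ₑ ^ 2) atTop (𝓝 0) :=
      ENNReal.tendsto_atTop_zero_of_tsum_ne_top hx.ne
    have h2 : Tendsto (fun n => ‖h n x - g n x‖ₑ) atTop (𝓝 0) := by
      have := (ENNReal.continuous_rpow_const (y := (1 / 2 : ℝ))).tendsto 0 |>.comp h1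
      rw [ENNReal.zero_rpow_of_pos (by norm_num)] at this
      refine this.congr fun n => ?_
      simp only [Function.comp_apply]
      rw [← ENNReal.rpow_natCast, ← ENNReal.rpow_mul]
      norm_num
    have h3 : Tendsto (fun n => h n x - g n x) atTop (𝓝 0) := by
      rw [tendsto_zero_iff_norm_tendsto_zero]
      have := (ENNReal.tendsto_toReal ENNReal.zero_ne_top).comp h2
      simpa [Function.comp_def] using this
    have h4 : Tendsto (fun n => h n x - (h n x - g n x)) atTop (𝓝 (f x - 0)) := by
      refine Tendsto.sub (tendsto_const_nhds.congr' ?_) h3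
      obtain ⟨N, hN⟩ := exists_nat_ge ‖f x‖
      filter_upwards [eventually_ge_atTop N] with n hn
      have : ‖f x‖ ≤ n := hN.trans (by exact_mod_cast hn)
      simp [hdef, this]
    simpa using h4

end approximation

/-! ### Almost everywhere convergence of block means -/

variable {D : ℕ} {M : Fin D → ℕ}

lemma continuous_prod_kernel {K : (i : Fin D) → (Fin (M i) → UnitAddCircle) → ℂ}
    (hK : ∀ i, Continuous (K i)) (x : BlockTorus M) :
    Continuous fun t : BlockTorus M => ∏ i, K i (x i - t i) :=
  continuous_finsetProd _ fun i _ =>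
    (hK i).comp (continuous_const.sub (continuous_apply i))

lemma integrable_prod_kernel_mul {K : (i : Fin D) → (Fin (M i) → UnitAddCircle) → ℂ}
    (hK : ∀ i, Continuous (K i)) {f : BlockTorus M → ℂ} (hf : Integrable f) (x : BlockTorus M) :
    Integrable fun t : BlockTorus M => (∏ i, K i (x i - t i)) * f t := by
  have hc := continuous_prod_kernel hK x
  obtain ⟨B, hB⟩ := isCompact_univ.exists_bound_of_continuousOn hc.continuousOn
  exact hf.bdd_mul hc.aestronglyMeasurable (ae_of_all _ fun t => hB t (Set.mem_univ t))

lemma blockMean_sub {K : (i : Fin D) → (Fin (M i) → UnitAddCircle) → ℂ}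
    (hK : ∀ i, Continuous (K i)) {f g : BlockTorus M → ℂ} (hf : Integrable f) (hg : Integrable g)
    (x : BlockTorus M) :
    blockMean K (fun t => f t - g t) x = blockMean K f x - blockMean K g x := by
  unfold blockMean
  rw [← integral_sub (integrable_prod_kernel_mul hK hf x) (integrable_prod_kernel_mul hK hg x)]
  simp_rw [mul_sub]

lemma blockMean_blockChar (K : (i : Fin D) → (Fin (M i) → UnitAddCircle) → ℂ)
    (ν : (i : Fin D) → Fin (M i) → ℤ) (x : BlockTorus M) :
    blockMean K (blockChar ν) x = ∏ i, ∫ s, K i (x i - s) * torusChar (ν i) s := by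
  rw [← integral_fintype_prod_volume_eq_prod, blockMean]
  simp_rw [Finset.prod_mul_distrib]
  rfl

/-- Means with continuous kernels converge on trigonometric polynomials as soon as they converge
on the characters of each block. -/
lemma tendsto_blockMean_of_trigPolynomial {α : Type*} {F : Filter α}
    {K : α → (i : Fin D) → (Fin (M i) → UnitAddCircle) → ℂ}
    (hK : ∀ᶠ a in F, ∀ i, Continuous (K a i))
    (hchar : ∀ i (ν : Fin (M i) → ℤ) y,
      Tendsto (fun a => ∫ s, K a i (y - s) * torusChar ν s) F (𝓝 (torusChar ν y)))
    {g : C(BlockTorus M, ℂ)} (hg : g ∈ trigPolynomials M) (x : BlockTorus M) :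
    Tendsto (fun a => blockMean (K a) g x) F (𝓝 (g x)) := by
  have hint : ∀ g : C(BlockTorus M, ℂ), Integrable (fun x => g x) :=
    fun g => integrable_of_continuous g.continuous
  refine Submodule.span_induction
    (p := fun (g : C(BlockTorus M, ℂ)) _ =>
      Tendsto (fun a => blockMean (K a) g x) F (𝓝 (g x))) ?_ ?_ ?_ ?_ hg
  · rintro _ ⟨ν, rfl⟩
    simp_rw [blockMean_blockChar]
    exact tendsto_finsetProd _ fun i _ => hchar i (ν i) (x i)
  · simpa [blockMean] using tendsto_const_nhds
  · intro g h _ _ hg hh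
    refine (hg.add hh).congr' ?_
    filter_upwards [hK] with a ha
    unfold blockMean
    rw [← integral_add (integrable_prod_kernel_mul ha (hint g) x)
      (integrable_prod_kernel_mul ha (hint h) x)]
    simp_rw [← mul_add]
    rfl
  · intro c g _ hg
    refine (hg.const_mul c).congr fun a => ?_
    unfold blockMean
    rw [← integral_const_mul]
    refine integral_congr_ae (ae_of_all _ fun t => ?_)
    simp only [ContinuousMap.coe_smul, Pi.smul_apply, smul_eq_mul]
    ring

/-- The composition of the maximal operators of all blocks. -/
def blockMaximal (M : Fin D → ℕ) (h : BlockTorus M → ℝ≥0∞) : BlockTorus M → ℝ≥0∞ :=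
  iterOp (fun i => coordOp i (torusMaximal (M i))) (List.finRange D) h

lemma measurable_coordOp_torusMaximal (i : Fin D) (h : BlockTorus M → ℝ≥0∞) (hh : Measurable h) :
    Measurable (coordOp i (torusMaximal (M i)) h) :=
  measurable_torusMaximal_param (Z := BlockTorus M) (H := fun x s => h (Function.update x i s))
    (hh.comp measurable_update') (measurable_pi_apply i)

lemma ae_iInf_blockMaximal_eq_zero (hM : ∀ i, 1 ≤ M i) {G : ℕ → BlockTorus M → ℝ≥0∞}
    (hm : ∀ n, Measurable (G n)) (hanti : Antitone G) (hfin : dyadicLLog volume (D - 1) (G 0) < ∞)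
    (h0 : ∀ᵐ x, ⨅ n, G n x = 0) : ∀ᵐ x, ⨅ n, blockMaximal M (G n) x = 0 := by
  choose b C hC hT using fun i => isMaximalOperator_torusMaximal (hM i)
  refine ae_iInf_iterOp_eq_zero (fun i => isMaximalOperator_coordOp i (hT i)
    (measurable_coordOp_torusMaximal i)) hC (List.finRange D) hm hanti ?_ h0
  rwa [List.length_finRange]

lemma blockMaximal_mono (hM : ∀ i, 1 ≤ M i) : Monotone (blockMaximal M) := by
  choose b C hC hT using fun i => isMaximalOperator_torusMaximal (hM i)
  exact iterOp_mono (fun i => isMaximalOperator_coordOp i (hT i)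
    (measurable_coordOp_torusMaximal i)) _

/-- Means with box dominated kernels are controlled by the maximal operator. -/
lemma enorm_blockMean_le {c : Fin D → ℝ} (hc : ∀ i, 0 ≤ c i)
    {K : (i : Fin D) → (Fin (M i) → UnitAddCircle) → ℂ} (hK : ∀ i, IsBoxDominated (c i) (K i))
    {f : BlockTorus M → ℂ} (hf : Measurable f) (x : BlockTorus M) :
    ‖blockMean K f x‖ₑ ≤
      (∏ i, ENNReal.ofReal (c i)) * blockMaximal M (fun t => ‖f t‖ₑ) x := by
  choose k hk using fun i => (hK i).enorm_le (hc i)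
  set κ : (i : Fin D) → (Fin (M i) → UnitAddCircle) → (Fin (M i) → UnitAddCircle) → ℝ≥0∞ :=
    fun i y t => torusKernel (M i) (k i) (y - t) with hκ
  have hκm : ∀ i, Measurable (Function.uncurry (κ i)) := fun i =>
    (measurable_torusKernel (M i) (k i)).comp (measurable_fst.sub measurable_snd)
  have hdom := lmarginal_prod_le_iterOp hκm (T := fun i => torusMaximal (M i))
    (fun i g hg y => lintegral_torusKernel_mul_le (M i) (k i) hg y)
    measurable_coordOp_torusMaximal hf.enorm (List.nodup_finRange D) x
  rw [List.toFinset_finRange, lmarginal_univ] at hdom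
  calc ‖blockMean K f x‖ₑ ≤ ∫⁻ t : BlockTorus M, ‖(∏ i, K i (x i - t i)) * f t‖ₑ :=
        enorm_integral_le_lintegral_enorm _
    _ ≤ ∫⁻ t : BlockTorus M, (∏ i, ENNReal.ofReal (c i)) * ((∏ i, κ i (x i) (t i)) * ‖f t‖ₑ) := by
        refine lintegral_mono fun t => ?_
        rw [enorm_mul, ← mul_assoc, ← Finset.prod_mul_distrib]
        gcongr
        rw [← ofReal_norm, norm_prod, ENNReal.ofReal_prod_of_nonneg fun _ _ => norm_nonneg _]
        refine Finset.prod_le_prod' fun i _ => ?_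
        rw [ofReal_norm]
        exact hk i _
    _ = (∏ i, ENNReal.ofReal (c i)) * ∫⁻ t : BlockTorus M, (∏ i, κ i (x i) (t i)) * ‖f t‖ₑ :=
        lintegral_const_mul' _ _ (ENNReal.prod_ne_top fun i _ => ENNReal.ofReal_ne_top)
    _ ≤ _ := by
        gcongr
        exact hdom

/-- Almost everywhere convergence of all means with continuous box dominated kernels that
converge on characters, with one exceptional null set. -/
theorem ae_tendsto_blockMean (hM : ∀ i, 1 ≤ M i) {f : BlockTorus M → ℂ}
    (hf : MemLLogL f (D - 1) volume) :
    ∀ᵐ x : BlockTorus M, ∀ (α : Type) (F : Filter α)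
      (K : α → (i : Fin D) → (Fin (M i) → UnitAddCircle) → ℂ) (c : Fin D → ℝ), (∀ i, 0 ≤ c i) →
      (∀ᶠ a in F, ∀ i, Continuous (K a i)) → (∀ᶠ a in F, ∀ i, IsBoxDominated (c i) (K a i)) →
      (∀ i (ν : Fin (M i) → ℤ) y,
        Tendsto (fun a => ∫ s, K a i (y - s) * torusChar ν s) F (𝓝 (torusChar ν y))) →
      Tendsto (fun a => blockMean (K a) f x) F (𝓝 (f x)) := by
  set f' := hf.1.mk f with hf'
  have hff' : f =ᵐ[volume] f' := hf.1.ae_eq_mk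
  have hfm : Measurable f' := hf.1.stronglyMeasurable_mk.measurable
  have hfin := (hf.congr hff').dyadicLLog_lt_top hfm
  have hfint : Integrable f' :=
    ⟨hfm.aestronglyMeasurable, lintegral_lt_top_of_dyadicLLog hfm.enorm hfin⟩
  obtain ⟨g, hg, hgfin, hgae⟩ := exists_trigPolynomials_tendsto hfm hfin
  -- The tails majorize the errors and decrease in `N`, so monotonicity of the maximal operator
  -- replaces sublinearity.
  set G : ℕ → BlockTorus M → ℝ≥0∞ := fun N x => ⨆ n, ‖f' x - g (N + n) x‖ₑ with hG
  have hle : ∀ N x, ‖f' x - g N x‖ₑ ≤ G N x := fun N x =>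
    le_iSup (fun n => ‖f' x - g (N + n) x‖ₑ) 0
  have hGm : ∀ N, Measurable (G N) := fun N =>
    Measurable.iSup fun n => (hfm.sub (g (N + n)).continuous.measurable).enorm
  have hanti : Antitone G := by
    intro N N' hN x
    refine iSup_le fun n => ?_
    have := le_iSup (fun n => ‖f' x - g (N + n) x‖ₑ) (N' - N + n)
    rwa [show N + (N' - N + n) = N' + n by omega] at this
  have hG0 : ∀ᵐ x, ⨅ N, G N x = 0 := by
    filter_upwards [hgae] with x hx
    refine le_antisymm (le_of_forall_gt fun ε hε => ?_) zero_le
    obtain ⟨δ, hδ0, hδε⟩ := exists_between hε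
    have hlim : Tendsto (fun n => ‖f' x - g n x‖ₑ) atTop (𝓝 0) := by
      have := (tendsto_const_nhds (x := f' x)).sub hx
      rw [sub_self] at this
      simpa using this.enorm
    obtain ⟨N, hN⟩ := eventually_atTop.1 (hlim.eventually (ge_mem_nhds hδ0))
    refine lt_of_le_of_lt (iInf_le _ N) (lt_of_le_of_lt (iSup_le fun n => ?_) hδε)
    exact hN _ (Nat.le_add_right N n)
  have hTG := ae_iInf_blockMaximal_eq_zero hM hGm hanti (by simpa [hG] using hgfin) hG0
  -- The null set is fixed before the kernels, filter and constants are introduced; these affect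
  -- only the factor `P`.
  filter_upwards [hff', hG0, hTG] with x hx hx0 hxT α F K c hc hKc hKd hchar
  have hmean : ∀ a, blockMean (K a) f x = blockMean (K a) f' x := fun a =>
    integral_congr_ae (hff'.mono fun t ht => by simp only [ht])
  simp_rw [hmean, hx]
  rw [tendsto_iff_edist_tendsto_0, ENNReal.tendsto_nhds_zero]
  intro ε hε
  set P := ∏ i, ENNReal.ofReal (c i) with hP
  have hPt : P ≠ ∞ := ENNReal.prod_ne_top fun i _ => ENNReal.ofReal_ne_top
  have hε3 : 0 < ε / 3 := ENNReal.div_pos hε.ne' (by simp)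
  obtain ⟨N₁, hN₁⟩ : ∃ N, G N x < ε / 3 := iInf_lt_iff.1 (hx0 ▸ hε3)
  obtain ⟨N₂, hN₂⟩ : ∃ N, P * blockMaximal M (G N) x < ε / 3 := by
    have : ⨅ N, P * blockMaximal M (G N) x = 0 := by
      rw [← ENNReal.mul_iInf fun h => absurd h hPt, hxT, mul_zero]
    exact iInf_lt_iff.1 (this ▸ hε3)
  set N := max N₁ N₂
  have hlim := tendsto_blockMean_of_trigPolynomial hKc hchar (hg N) x
  rw [tendsto_iff_edist_tendsto_0, ENNReal.tendsto_nhds_zero] at hlim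
  filter_upwards [hKc, hKd, hlim (ε / 3) hε3] with a hac had hag
  have hgint : Integrable (fun t => g N t) := integrable_of_continuous (g N).continuous
  have h1 : edist (blockMean (K a) f' x) (blockMean (K a) (g N) x) ≤ ε / 3 := by
    rw [edist_eq_enorm_sub, ← blockMean_sub hac hfint hgint]
    calc _ ≤ P * blockMaximal M (fun t => ‖f' t - g N t‖ₑ) x :=
          enorm_blockMean_le hc had (hfm.sub (g N).continuous.measurable) x
      _ ≤ P * blockMaximal M (G N₂) x := by
          gcongr
          exact blockMaximal_mono hM
            (fun t => (hle N t).trans (hanti (le_max_right N₁ N₂) t)) x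
      _ ≤ ε / 3 := hN₂.le
  have h3 : edist (g N x) (f' x) ≤ ε / 3 := by
    rw [edist_comm, edist_eq_enorm_sub]
    exact (hle N x).trans ((hanti (le_max_left N₁ N₂) x).trans hN₁.le)
  calc edist (blockMean (K a) f' x) (f' x)
      ≤ edist (blockMean (K a) f' x) (blockMean (K a) (g N) x) +
        edist (blockMean (K a) (g N) x) (g N x) + edist (g N x) (f' x) := edist_triangle4 _ _ _ _
    _ ≤ ε / 3 + ε / 3 + ε / 3 := by gcongr
    _ = ε := ENNReal.add_thirds ε

end FourierMeans
end

theorem mainTheorem2 (D : ℕ) (hD : 1 ≤ D) (M : Fin D → ℕ) (hM : ∀ i, 1 ≤ M i)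
    (f : FourierMeans.BlockTorus M → ℂ) (hf : FourierMeans.MemLLogL f (D - 1) volume) :
    (∀ᵐ x : FourierMeans.BlockTorus M, ∀ C : ℝ,
      Tendsto (fun n => FourierMeans.fejerMean n f x)
        (FourierMeans.boundedGrowth M C) (𝓝 (f x))) ∧
    (∀ᵐ x : FourierMeans.BlockTorus M, ∀ C : ℝ,
      Tendsto (fun r => FourierMeans.abelPoissonMean r f x)
        (FourierMeans.boundedGrowthAbel M C) (𝓝 (f x))) ∧
    (∀ᵐ x : FourierMeans.BlockTorus M,
      Tendsto (fun n => FourierMeans.marcinkiewiczMean n f x) atTop (𝓝 (f x))) := by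
  -- The same exceptional set serves the three families of means and every `C`.
  have hae := FourierMeans.ae_tendsto_blockMean hM hf
  refine ⟨hae.mono fun x hx C => ?_, hae.mono fun x hx C => ?_, hae.mono fun x hx => ?_⟩
  · refine hx _ (FourierMeans.boundedGrowth M C)
      (fun n i => FourierMeans.fejerKernelMulti (n i))
      (fun i => (8 * 2 * max C 1) ^ M i) (fun i => by positivity)
      (Eventually.of_forall fun n i => FourierMeans.continuous_fejerKernelMulti _) ?_
      (FourierMeans.tendsto_integral_fejerKernelMulti_mul C)
    filter_upwards [mem_inf_of_right (mem_principal_self _)] with n hn i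
    exact FourierMeans.isBoxDominated_fejer (hM i) C (hn i)
  · refine hx _ (FourierMeans.boundedGrowthAbel M C)
      (fun r i => FourierMeans.poissonKernelMulti (r i))
      (fun i => (8 * 2 * max C 1) ^ M i) (fun i => by positivity) ?_ ?_
      (FourierMeans.tendsto_integral_poissonKernelMulti_mul C)
    · filter_upwards [FourierMeans.eventually_boundedGrowthAbel C] with r hr i
      exact FourierMeans.continuous_poissonKernelMulti (hr.1 i)
    · filter_upwards [FourierMeans.eventually_boundedGrowthAbel C] with r hr i
      exact FourierMeans.isBoxDominated_poisson (hM i) C (hr.1 i) (hr.2 i)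
  · have hdom : ∀ (n : Fin D → ℕ) i, FourierMeans.IsBoxDominated
        ((2 : ℝ) ^ M i * (M i + 2) * M i * 8 ^ M i)
        (FourierMeans.marcinkiewiczKernel (m := M i) (n i)) :=
      fun n i => FourierMeans.isBoxDominated_marcinkiewicz (hM i) (n i)
    have hc : ∀ i, 0 ≤ (2 : ℝ) ^ M i * (M i + 2) * M i * 8 ^ M i := fun i => by positivity
    refine hx (Fin D → ℕ) atTop (fun n i => FourierMeans.marcinkiewiczKernel (n i)) _ hc
      (Eventually.of_forall fun n i => FourierMeans.continuous_marcinkiewiczKernel _)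
      (Eventually.of_forall hdom) ?_
    intro i ν y
    have hi : Tendsto (fun n : Fin D → ℕ => n i) atTop atTop := tendsto_atTop.2 fun b =>
      (eventually_ge_atTop fun _ => b).mono fun n hn => hn i
    have h := (FourierMeans.tendsto_integral_marcinkiewiczKernel_mul ν y).comp hi
    exact h
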